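/- Let $\Omega$ be $(0,1)$ or $(0,\infty)$ with Lebesgue measure, or $\mathbb{N}=\{1,2,\dots\}$ with counting measure; write $\mu$ for the measure. For a measurable $f\colon\Omega\to\mathbb{R}$ put $d_f(\lambda)=\mu(\{t\in\Omega:|f(t)|>\lambda\})$ for $\lambda\ge 0$, and let $f^*$ be the non-increasing rearrangement of $f$, that is, $f^*(t)=\inf\{\lambda>0: d_f(\lambda)\le t\}$ if $\Omega=(0,1)$ or $\Omega=(0,\infty)$, and $f^*(n)=\inf\{\lambda>0: d_f(\lambda)<n\}$ if $\Omega=\mathbb{N}$ (with $\inf\emptyset=\infty$). Let $X$ be a rearrangement invariant space on $\Omega$: a Banach space $(X,\|\cdot\|_X)$ which is a linear subspace of the space $L_0(\Omega)$ of classes of measurable real functions modulo equality almost everywhere, which contains an almost everywhere positive function, and is such that (i) if $g\in X$, $f\in L_0(\Omega)$ and $|f|\le|g|$ almost everywhere, then $f\in X$ and $\|f\|_X\le\|g\|_X$; (ii) if $f\in X$, $g\in L_0(\Omega)$ and $d_f=d_g$, then $g\in X$ and $\|f\|_X=\|g\|_X$. Let $X_a$ be the set of order continuous elements of $X$, i.e.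 of those $f\in X$ such that $\|f_n\|_X\to 0$ for every sequence $(f_n)$ in $X$ with $0\le f_n\le|f|$, $f_{n+1}\le f_n$ and $\inf_n f_n=0$. For $f\in X$ put $\operatorname{dist}(f,X_a)=\inf\{\|f-g\|_X: g\in X_a\}$. **Theorem.** Suppose that $X_a\neq\{0\}$, and put $\Omega_n=\Omega\cap\left((0,\tfrac1n)\cup(n,\infty)\right)$. Then for every $f\in X$ the rearrangement $f^*$ is finite at every point of $\Omega$ and (restricted to $\Omega$) belongs to $X$, the limit $\lim_{n\to\infty}\|f^*\chi_{\Omega_n}\|_X$ exists, and $$\operatorname{dist}(f^*,X_a)=\lim_{n\to\infty}\|f^*\chi_{\Omega_n}\|_X ,\qquad \operatorname{dist}(f,X_a)=\lim_{n\to\infty}\|f^*\chi_{\Omega_n}\|_X .$$ (The Fatou property of $X$ is not assumed.) -/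

import Mathlib

open Set Filter Topology MeasureTheory
open scoped ENNReal

noncomputable section

/-- The distribution function `d_f(s) = μ {t : |f t| > s}` of a class `f` of measurable functions. -/
def distributionFun {α : Type*} [MeasurableSpace α] {μ : Measure α} (f : α →ₘ[μ] ℝ) (s : ℝ) :
    ℝ≥0∞ :=
  μ {t | s < |f t|}

/-- Two (classes of) functions are equimeasurable if their distribution functions agree on
`[0, ∞)`. -/
def Equimeasurable {α : Type*} [MeasurableSpace α] {μ : Measure α} (f g : α →ₘ[μ] ℝ) : Prop :=
  ∀ s : ℝ, 0 ≤ s → distributionFun f s = distributionFun g s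

/-- A Banach ideal space on `(α, μ)`: a linear subspace of `L⁰(μ)` with a complete norm which has
the ideal property and contains a weak unit. -/
structure BanachIdealSpace {α : Type*} [MeasurableSpace α] (μ : Measure α) where
  /-- the underlying linear subspace of `L⁰(μ)` -/
  carrier : Submodule ℝ (α →ₘ[μ] ℝ)
  /-- the norm; it is a seminorm which, by the next field, separates points -/
  norm : Seminorm ℝ carrier
  eq_zero_of_norm_eq_zero : ∀ f : carrier, norm f = 0 → f = 0
  complete : ∀ u : ℕ → carrier,
    (∀ ε : ℝ, 0 < ε → ∃ N : ℕ, ∀ m n : ℕ, N ≤ m → N ≤ n → norm (u m - u n) < ε) →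
    ∃ f : carrier, Tendsto (fun n => norm (u n - f)) atTop (𝓝 0)
  ideal_mem : ∀ f g : α →ₘ[μ] ℝ, |f| ≤ |g| → g ∈ carrier → f ∈ carrier
  ideal_norm : ∀ f g : carrier, |(f : α →ₘ[μ] ℝ)| ≤ |(g : α →ₘ[μ] ℝ)| → norm f ≤ norm g
  exists_weakUnit : ∃ u ∈ carrier, ∀ᵐ t ∂μ, 0 < u t

/-- A rearrangement invariant (symmetric) space on `(α, μ)`. -/
structure RearrangementInvariantSpace {α : Type*} [MeasurableSpace α] (μ : Measure α) extends
    BanachIdealSpace μ where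
  rearrangement_mem : ∀ f g : α →ₘ[μ] ℝ, Equimeasurable f g → f ∈ carrier → g ∈ carrier
  rearrangement_norm : ∀ f g : carrier,
    Equimeasurable (f : α →ₘ[μ] ℝ) (g : α →ₘ[μ] ℝ) → norm f = norm g

namespace BanachIdealSpace

variable {α : Type*} [MeasurableSpace α] {μ : Measure α}

/-- The set `X_a` of order continuous elements of `X`: those `f` for which `‖u n‖ → 0` whenever
`0 ≤ u n ≤ |f|` and `u n ↓ 0` (the infimum is the one of the lattice `X`). -/
def orderContinuousPart (X : BanachIdealSpace μ) : Set X.carrier :=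
  {f | ∀ u : ℕ → X.carrier,
    (∀ n, 0 ≤ u n ∧ (u n : α →ₘ[μ] ℝ) ≤ |(f : α →ₘ[μ] ℝ)|) →
    (∀ n, u (n + 1) ≤ u n) → IsGLB (range u) 0 →
    Tendsto (fun n => X.norm (u n)) atTop (𝓝 0)}

/-- The distance `inf {‖f - g‖ : g ∈ M}` from `f` to a subset `M` of `X`. -/
def distTo (X : BanachIdealSpace μ) (f : X.carrier) (M : Set X.carrier) : ℝ :=
  sInf ((fun g => X.norm (f - g)) '' M)

/-- For `f ∈ X` and a measurable set `S`, the element `f χ_S` of `X`. -/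
def cut (X : BanachIdealSpace μ) (f : X.carrier) (S : Set α) (hS : MeasurableSet S) :
    X.carrier :=
  ⟨AEEqFun.mk (S.indicator (f : α →ₘ[μ] ℝ))
      ((f : α →ₘ[μ] ℝ).aestronglyMeasurable.indicator hS), by
    refine X.ideal_mem _ (f : α →ₘ[μ] ℝ) ?_ f.2
    rw [← AEEqFun.coeFn_le]
    filter_upwards [AEEqFun.coeFn_abs (f : α →ₘ[μ] ℝ),
      AEEqFun.coeFn_abs (AEEqFun.mk (S.indicator (f : α →ₘ[μ] ℝ))
        ((f : α →ₘ[μ] ℝ).aestronglyMeasurable.indicator hS)),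
      AEEqFun.coeFn_mk (S.indicator (f : α →ₘ[μ] ℝ))
        ((f : α →ₘ[μ] ℝ).aestronglyMeasurable.indicator hS)] with t h1 h2 h3
    rw [h1, h2, h3]
    by_cases ht : t ∈ S <;> simp [ht]⟩

end BanachIdealSpace

/-- All sets of positive integers are measurable. -/
instance instMeasurableSpacePosInt : MeasurableSpace ℕ+ := ⊤

instance instDiscreteMeasurableSpacePosInt : DiscreteMeasurableSpace ℕ+ := ⟨fun _ => trivial⟩

/-- The non-increasing rearrangement `f*(t) = inf {s > 0 : d_f(s) ≤ t}`, for `t ≥ 0`, with values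
in `[0, ∞]` and `inf ∅ = ∞`. -/
def rearrangement {α : Type*} [MeasurableSpace α] {μ : Measure α} (f : α →ₘ[μ] ℝ) (t : ℝ) :
    ℝ≥0∞ :=
  ⨅ (s : ℝ) (_ : 0 < s ∧ distributionFun f s ≤ ENNReal.ofReal t), ENNReal.ofReal s

/-- The non-increasing rearrangement `x*_n = inf {s > 0 : d_x(s) < n}` of a sequence, `n ≥ 1`. -/
def seqRearrangement (x : ℕ+ →ₘ[(Measure.count : Measure ℕ+)] ℝ) (n : ℕ+) : ℝ≥0∞ :=
  ⨅ (s : ℝ) (_ : 0 < s ∧ distributionFun x s < ((n : ℕ) : ℝ≥0∞)), ENNReal.ofReal s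

lemma antitone_rearrangement {α : Type*} [MeasurableSpace α] {μ : Measure α} (f : α →ₘ[μ] ℝ) :
    Antitone (rearrangement f) := by
  intro a b hab
  refine le_iInf₂ fun s hs => ?_
  exact iInf₂_le s ⟨hs.1, hs.2.trans (ENNReal.ofReal_le_ofReal hab)⟩

/-- The class of `f*` in `L⁰(Ω)`, for `Ω ⊆ ℝ` with Lebesgue measure; meaningful where `f*` is
finite. -/
def rearrangementClass {Ω : Set ℝ} (f : ℝ →ₘ[volume.restrict Ω] ℝ) :
    ℝ →ₘ[volume.restrict Ω] ℝ :=
  AEEqFun.mk (fun t => (rearrangement f t).toReal)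
    (antitone_rearrangement f).measurable.ennreal_toReal.aestronglyMeasurable

/-- The sequence `x*`, as an element of `L⁰(ℕ)`; meaningful where `x*` is finite. -/
def seqRearrangementClass (x : ℕ+ →ₘ[(Measure.count : Measure ℕ+)] ℝ) :
    ℕ+ →ₘ[(Measure.count : Measure ℕ+)] ℝ :=
  AEEqFun.mk (fun n => (seqRearrangement x n).toReal)
    (measurable_of_countable _).aestronglyMeasurable

/-- The set `Ω_n = Ω ∩ ((0, 1/n) ∪ (n, ∞))`. -/
def outerSet (Ω : Set ℝ) (n : ℕ) : Set ℝ :=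
  Ω ∩ (Ioo 0 (1 / (n : ℝ)) ∪ Ioi (n : ℝ))

/-- The set `Ω_n = ℕ ∩ ((0, 1/n) ∪ (n, ∞))` of positive integers. -/
def seqOuterSet (n : ℕ) : Set ℕ+ :=
  {k | ((k : ℕ) : ℝ) ∈ Ioo 0 (1 / (n : ℝ)) ∪ Ioi (n : ℝ)}

lemma measurableSet_outerSet {Ω : Set ℝ} (hΩ : Ω = Ioo 0 1 ∨ Ω = Ioi 0) (n : ℕ) :
    MeasurableSet (outerSet Ω n) := by
  have h : MeasurableSet Ω := by
    rcases hΩ with rfl | rfl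
    · exact measurableSet_Ioo
    · exact measurableSet_Ioi
  exact h.inter (measurableSet_Ioo.union measurableSet_Ioi)

lemma measurableSet_seqOuterSet (n : ℕ) : MeasurableSet (seqOuterSet n) :=
  (Set.to_countable _).measurableSet

end

/-!
The limit of `‖f* χ_{Ω_n}‖` is compared with `dist(f, X_a)` from both sides, using only
distribution functions. All three spaces are treated at once, through a coordinate `τ`
(`IsCoordinate`) whose sublevel sets realise every value of the measure; `f*` is read along `τ`.

An element `f` of `X` has a finite distribution function somewhere, as otherwise `f` and `2 f` would
be equimeasurable and `f = 0`. Hence `f*` is finite and equimeasurable with `f`, and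
`d_f ≤ d_g` implies `‖f‖ ≤ ‖g‖`, because `f* ≤ g*`
(`mem_and_norm_le_of_distributionFun_le`). If `X_a ≠ {0}`, indicators of small sets have small norm
(`FundamentalVanishes`), so that every bounded function supported on a set of finite measure is
order continuous (`mem_orderContinuousPart_of_bounded`).

*Upper bound* (`distTo_le_norm_cut_starAlong`). Cut out of `f` the part where `|f|` lies between
`f*(n)` and `f*(1/n)` and exceeds `f*(∞)`. That part is bounded with support of finite measure, and
the distribution function of the remainder is at most that of `f* χ_{Ω_n}`.

*Lower bound* (`norm_cut_starAlong_le`). An order continuous `g` is a norm limit of functions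
bounded by some `k` and supported on a set of finite measure `b`. For such a `g`, with `h = f - g`,
one has `d_f(s + k) ≤ d_h(s)` and `d_f(s) ≤ d_h(s) + b`. For large `n` these give
`d_u ≤ d_h` for `u = (f* - k)⁺ χ_{(0, 1/n)} + f* χ_{(n, ∞)}`, hence
`‖f* χ_{Ω_n}‖ ≤ ‖h‖ + k ‖χ_{(0, 1/n)}‖`, where the last term tends to zero.

Since `f` and `f*` have the same rearrangement, the result for `f` also gives the one for `f*`.
-/

open scoped NNReal

/-! ### Distribution functions and rearrangements along a coordinate -/

section Distribution

variable {α : Type*} [MeasurableSpace α] {μ : Measure α}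

lemma measurableSet_lt_abs (f : α →ₘ[μ] ℝ) (s : ℝ) : MeasurableSet {t | s < |f t|} :=
  measurableSet_lt measurable_const f.measurable.abs

lemma distributionFun_anti (f : α →ₘ[μ] ℝ) : Antitone (distributionFun f) := fun _ _ hab =>
  measure_mono fun _ ht => lt_of_le_of_lt hab ht

/-- The distribution function is right-continuous, in the form in which it is used. -/
lemma exists_gt_lt_distributionFun (f : α →ₘ[μ] ℝ) {s : ℝ} {b : ℝ≥0∞}
    (h : b < distributionFun f s) : ∃ s', s < s' ∧ b < distributionFun f s' := by
  have hmono : Monotone fun n : ℕ => {t | s + 1 / ((n : ℝ) + 1) < |f t|} := by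
    intro m n hmn t (ht : s + 1 / ((m : ℝ) + 1) < |f t|)
    refine lt_of_le_of_lt ?_ ht
    have := Nat.one_div_le_one_div (α := ℝ) hmn
    simpa using this
  have hU : (⋃ n : ℕ, {t | s + 1 / ((n : ℝ) + 1) < |f t|}) = {t | s < |f t|} := by
    ext t
    simp only [mem_iUnion, mem_ofPred_eq]
    constructor
    · rintro ⟨n, hn⟩
      have : (0 : ℝ) < 1 / ((n : ℝ) + 1) := Nat.one_div_pos_of_nat
      linarith
    · intro ht
      obtain ⟨n, hn⟩ := exists_nat_one_div_lt (sub_pos.2 ht)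
      exact ⟨n, by linarith⟩
  have ht := tendsto_measure_iUnion_atTop (μ := μ) hmono
  rw [hU] at ht
  obtain ⟨n, hn⟩ := (ht.eventually (lt_mem_nhds h)).exists
  exact ⟨_, by linarith [Nat.one_div_pos_of_nat (α := ℝ) (n := n)], hn⟩

/-- If the distribution function is finite somewhere, it tends to zero at infinity. -/
lemma exists_distributionFun_lt (f : α →ₘ[μ] ℝ) (hf : ∃ s, distributionFun f s < ∞)
    {δ : ℝ≥0∞} (hδ : 0 < δ) : ∃ s, 0 < s ∧ distributionFun f s < δ := by
  obtain ⟨s₀, hs₀⟩ := hf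
  have hanti : Antitone fun n : ℕ => {t | max s₀ 1 + (n : ℝ) < |f t|} := by
    intro m n hmn t (ht : max s₀ 1 + (n : ℝ) < |f t|)
    refine lt_of_le_of_lt ?_ ht
    have : (m : ℝ) ≤ n := by exact_mod_cast hmn
    linarith
  have hI : (⋂ n : ℕ, {t | max s₀ 1 + (n : ℝ) < |f t|}) = ∅ := by
    ext t
    simp only [mem_iInter, mem_ofPred_eq, mem_empty_iff_false, iff_false, not_forall, not_lt]
    obtain ⟨n, hn⟩ := exists_nat_ge |f t|
    exact ⟨n, by linarith [le_max_right s₀ 1]⟩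
  have ht := tendsto_measure_iInter_atTop (μ := μ)
    (fun n : ℕ => (measurableSet_lt_abs f (max s₀ 1 + (n : ℝ))).nullMeasurableSet) hanti
    ⟨0, ((distributionFun_anti f (by simp)).trans_lt hs₀).ne⟩
  rw [hI, measure_empty] at ht
  obtain ⟨n, hn⟩ := (ht.eventually (gt_mem_nhds hδ)).exists
  exact ⟨_, by have := le_max_right s₀ 1; positivity, hn⟩

/-- The rearrangement is the generalised inverse of the distribution function. -/
lemma ofReal_lt_rearrangement (f : α →ₘ[μ] ℝ) {s : ℝ} (hs : 0 ≤ s) (t : ℝ≥0) :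
    ENNReal.ofReal s < rearrangement f t ↔ (t : ℝ≥0∞) < distributionFun f s := by
  constructor
  · intro h
    by_contra! hd
    refine h.not_ge (ENNReal.le_of_forall_pos_le_add fun ε hε _ => ?_)
    have hε' : (0 : ℝ) < ε := hε
    refine (iInf₂_le (s + (ε : ℝ)) ⟨by linarith, ?_⟩).trans ?_
    · rw [ENNReal.ofReal_add hs hε'.le, ENNReal.ofReal_coe_nnreal]
    · rw [ENNReal.ofReal_coe_nnreal]
      exact (distributionFun_anti f (by linarith)).trans hd
  · intro h
    obtain ⟨s', hs', hd⟩ := exists_gt_lt_distributionFun f h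
    refine ((ENNReal.ofReal_lt_ofReal_iff (hs.trans_lt hs')).2 hs').trans_le
      (le_iInf₂ fun r hr => ENNReal.ofReal_le_ofReal ?_)
    by_contra! hlt
    have h1 := hr.2
    rw [ENNReal.ofReal_coe_nnreal] at h1
    exact (hd.trans_le ((distributionFun_anti f hlt.le).trans h1)).false

lemma lt_toReal_rearrangement (f : α →ₘ[μ] ℝ) {s : ℝ} (hs : 0 ≤ s) {t : ℝ≥0}
    (ht : rearrangement f t < ∞) :
    s < (rearrangement f t).toReal ↔ (t : ℝ≥0∞) < distributionFun f s := by
  rw [← ofReal_lt_rearrangement f hs, ENNReal.ofReal_lt_iff_lt_toReal hs ht.ne]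

lemma distributionFun_rearrangement_le (f : α →ₘ[μ] ℝ) {t : ℝ≥0}
    (ht : rearrangement f t < ∞) :
    distributionFun f (rearrangement f t).toReal ≤ t := by
  by_contra! h
  exact lt_irrefl _ ((lt_toReal_rearrangement f ENNReal.toReal_nonneg ht).2 h)

lemma rearrangement_mono_of_distributionFun_le {f g : α →ₘ[μ] ℝ}
    (h : ∀ s, 0 ≤ s → distributionFun f s ≤ distributionFun g s) (t : ℝ) :
    rearrangement f t ≤ rearrangement g t :=
  le_iInf₂ fun s hs => iInf₂_le s ⟨hs.1, (h s hs.1.le).trans hs.2⟩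

/-- `t` bounds the measures of all sets of sufficiently small measure. On an atomless space this
means `0 < t`; on a counting space it holds for every `t ≥ 0`. -/
def IsThreshold (μ : Measure α) (t : ℝ≥0) : Prop :=
  ∃ δ : ℝ≥0∞, 0 < δ ∧ ∀ A, MeasurableSet A → μ A < δ → μ A ≤ t

lemma IsThreshold.mono {t t' : ℝ≥0} (ht : IsThreshold μ t) (h : t ≤ t') : IsThreshold μ t' := by
  obtain ⟨δ, hδ, hA⟩ := ht
  exact ⟨δ, hδ, fun A hAm hAδ => (hA A hAm hAδ).trans (by exact_mod_cast h)⟩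

lemma IsThreshold.rearrangement_lt_top {t : ℝ≥0} (ht : IsThreshold μ t) (f : α →ₘ[μ] ℝ)
    (hf : ∃ s, distributionFun f s < ∞) : rearrangement f t < ∞ := by
  obtain ⟨δ, hδ, h⟩ := ht
  obtain ⟨s, hs, hd⟩ := exists_distributionFun_lt f hf hδ
  refine (iInf₂_le s ⟨hs, ?_⟩).trans_lt ENNReal.ofReal_lt_top
  rw [ENNReal.ofReal_coe_nnreal]
  exact h _ (measurableSet_lt_abs f s) hd

/-- The decreasing rearrangement of `f`, transported to `α` along a coordinate `τ`. -/
noncomputable def starAlong (τ : α → ℝ≥0) (hτ : Measurable τ) (f : α →ₘ[μ] ℝ) : α →ₘ[μ] ℝ :=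
  AEEqFun.mk (fun x => (rearrangement f (τ x)).toReal)
    (((antitone_rearrangement f).measurable.comp
      hτ.coe_nnreal_real).ennreal_toReal.aestronglyMeasurable)

lemma coeFn_starAlong {τ : α → ℝ≥0} (hτ : Measurable τ) (f : α →ₘ[μ] ℝ) :
    starAlong τ hτ f =ᵐ[μ] fun x => (rearrangement f (τ x)).toReal :=
  AEEqFun.coeFn_mk _ _

/-- A coordinate `τ` on `(α, μ)` along which functions can be rearranged, with cut-offs `ρ n` and
`σ n` for its small and its large values. It is the common frame for the interval `(0, 1)` and the
half-line, where `τ t = t`, and for the positive integers, where `τ k = k - 1`. -/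
structure IsCoordinate (μ : Measure α) (τ : α → ℝ≥0) (ρ σ : ℕ → ℝ≥0) : Prop where
  measurable : Measurable τ
  /-- The sublevel sets of `τ` realise every value of `μ`. -/
  measure_lt : ∀ A, MeasurableSet A → μ {x | (τ x : ℝ≥0∞) < μ A} = μ A
  isThreshold : ∀ n, IsThreshold μ (ρ n)
  le : ∀ n, ρ n ≤ σ n
  ae_isThreshold : ∀ᵐ x ∂μ, IsThreshold μ (τ x)
  tendsto_inner : Tendsto (fun n => μ {x | τ x < ρ n}) atTop (𝓝 0)
  measure_lt_top : ∀ n, μ {x | τ x < σ n} < ∞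
  /-- Either the sets `τ < σ n` have measure tending to infinity, or there is no tail. -/
  tail : Tendsto (fun n => μ {x | τ x < σ n}) atTop (𝓝 ∞) ∨ ∀ n, μ {x | σ n ≤ τ x} = 0
  /-- Every set of finite measure consists of two sets smaller than the whole space. -/
  split : ∃ S, MeasurableSet S ∧ ∀ B, μ B < ∞ → μ (B ∩ S) < μ univ ∧ μ (B \ S) < μ univ

namespace IsCoordinate

variable {τ : α → ℝ≥0} {ρ σ : ℕ → ℝ≥0}

lemma measure_lt_distributionFun (C : IsCoordinate μ τ ρ σ) (f : α →ₘ[μ] ℝ) (s : ℝ) :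
    μ {x | (τ x : ℝ≥0∞) < distributionFun f s} = distributionFun f s :=
  C.measure_lt _ (measurableSet_lt_abs f s)

lemma ae_rearrangement_lt_top (C : IsCoordinate μ τ ρ σ) (f : α →ₘ[μ] ℝ)
    (hf : ∃ s, distributionFun f s < ∞) : ∀ᵐ x ∂μ, rearrangement f (τ x) < ∞ := by
  filter_upwards [C.ae_isThreshold] with x hx using hx.rearrangement_lt_top f hf

lemma ae_lt_abs_starAlong (C : IsCoordinate μ τ ρ σ) (f : α →ₘ[μ] ℝ)
    (hf : ∃ s, distributionFun f s < ∞) :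
    ∀ᵐ x ∂μ, ∀ s, 0 ≤ s →
      (s < |starAlong τ C.measurable f x| ↔ (τ x : ℝ≥0∞) < distributionFun f s) := by
  filter_upwards [C.ae_rearrangement_lt_top f hf, coeFn_starAlong C.measurable f] with x h1 h2
  intro s hs
  rw [h2, abs_of_nonneg ENNReal.toReal_nonneg, lt_toReal_rearrangement f hs h1]

lemma equimeasurable_starAlong (C : IsCoordinate μ τ ρ σ) (f : α →ₘ[μ] ℝ)
    (hf : ∃ s, distributionFun f s < ∞) : Equimeasurable f (starAlong τ C.measurable f) := by
  intro s hs
  rw [← C.measure_lt_distributionFun f s]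
  refine measure_congr ?_
  filter_upwards [C.ae_lt_abs_starAlong f hf] with x hx
  exact propext (hx s hs).symm

end IsCoordinate

lemma Equimeasurable.symm {f g : α →ₘ[μ] ℝ} (h : Equimeasurable f g) : Equimeasurable g f :=
  fun s hs => (h s hs).symm

end Distribution

/-! ### Order continuity in Banach ideal spaces -/

namespace BanachIdealSpace

variable {α : Type*} [MeasurableSpace α] {μ : Measure α} (X : BanachIdealSpace μ)

lemma abs_le_abs_of_ae {f g : α →ₘ[μ] ℝ} (h : ∀ᵐ x ∂μ, |f x| ≤ |g x|) : |f| ≤ |g| := by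
  rw [← AEEqFun.coeFn_le]
  filter_upwards [h, AEEqFun.coeFn_abs f, AEEqFun.coeFn_abs g] with x h0 h1 h2
  rwa [h1, h2]

lemma ae_abs_abs (f : α →ₘ[μ] ℝ) : ∀ᵐ x ∂μ, |(|f| : α →ₘ[μ] ℝ) x| = |f x| := by
  filter_upwards [AEEqFun.coeFn_abs f] with x hx
  rw [hx, abs_abs]

lemma mem_of_ae_le {f g : α →ₘ[μ] ℝ} (hg : g ∈ X.carrier) (h : ∀ᵐ x ∂μ, |f x| ≤ |g x|) :
    f ∈ X.carrier :=
  X.ideal_mem f g (abs_le_abs_of_ae h) hg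

lemma norm_le_of_ae_le {f g : X.carrier}
    (h : ∀ᵐ x ∂μ, |(f : α →ₘ[μ] ℝ) x| ≤ |(g : α →ₘ[μ] ℝ) x|) : X.norm f ≤ X.norm g :=
  X.ideal_norm f g (abs_le_abs_of_ae h)

lemma coeFn_cut (f : X.carrier) {S : Set α} (hS : MeasurableSet S) :
    (X.cut f S hS : α →ₘ[μ] ℝ) =ᵐ[μ] S.indicator (f : α →ₘ[μ] ℝ) :=
  AEEqFun.coeFn_mk _ _

lemma coeFn_carrier_sub (f g : X.carrier) :
    ((f - g : X.carrier) : α →ₘ[μ] ℝ) =ᵐ[μ] fun x => (f : α →ₘ[μ] ℝ) x - (g : α →ₘ[μ] ℝ) x :=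
  AEEqFun.coeFn_sub _ _

lemma coeFn_carrier_add (f g : X.carrier) :
    ((f + g : X.carrier) : α →ₘ[μ] ℝ) =ᵐ[μ] fun x => (f : α →ₘ[μ] ℝ) x + (g : α →ₘ[μ] ℝ) x :=
  AEEqFun.coeFn_add _ _

lemma coeFn_carrier_smul (c : ℝ) (f : X.carrier) :
    ((c • f : X.carrier) : α →ₘ[μ] ℝ) =ᵐ[μ] fun x => c * (f : α →ₘ[μ] ℝ) x :=
  AEEqFun.coeFn_smul _ _

lemma le_abs_iff_ae {u : α →ₘ[μ] ℝ} {f : α →ₘ[μ] ℝ} :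
    u ≤ |f| ↔ ∀ᵐ x ∂μ, u x ≤ |f x| := by
  rw [← AEEqFun.coeFn_le]
  constructor
  · intro h
    filter_upwards [h, AEEqFun.coeFn_abs f] with x h1 h2
    rwa [h2] at h1
  · intro h
    filter_upwards [h, AEEqFun.coeFn_abs f] with x h1 h2
    rwa [h2]

lemma nonneg_iff_ae {u : X.carrier} : 0 ≤ u ↔ ∀ᵐ x ∂μ, 0 ≤ (u : α →ₘ[μ] ℝ) x := by
  rw [← Subtype.coe_le_coe, ← AEEqFun.coeFn_le]
  constructor
  · intro h
    filter_upwards [h, AEEqFun.coeFn_zero (μ := μ) (β := ℝ) (α := α)] with x h1 h2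
    simpa [h2] using h1
  · intro h
    filter_upwards [h, AEEqFun.coeFn_zero (μ := μ) (β := ℝ) (α := α)] with x h1 h2
    simpa [h2] using h1

/-- The infimum of a decreasing sequence, taken in the lattice `X`, is the pointwise limit. -/
lemma ae_tendsto_zero_of_isGLB {u : ℕ → X.carrier} (hu : ∀ n, 0 ≤ u n)
    (hanti : ∀ n, u (n + 1) ≤ u n) (hglb : IsGLB (range u) 0) :
    ∀ᵐ x ∂μ, Tendsto (fun n => (u n : α →ₘ[μ] ℝ) x) atTop (𝓝 0) := by
  have h0 : ∀ᵐ x ∂μ, ∀ n, 0 ≤ (u n : α →ₘ[μ] ℝ) x :=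
    ae_all_iff.2 fun n => X.nonneg_iff_ae.1 (hu n)
  have h1 : ∀ᵐ x ∂μ, ∀ n, (u (n + 1) : α →ₘ[μ] ℝ) x ≤ (u n : α →ₘ[μ] ℝ) x :=
    ae_all_iff.2 fun n => AEEqFun.coeFn_le.2 (hanti n)
  have hm : Measurable fun x => ⨅ n, (u n : α →ₘ[μ] ℝ) x :=
    Measurable.iInf fun n => (u n : α →ₘ[μ] ℝ).measurable
  set v : α →ₘ[μ] ℝ := AEEqFun.mk _ hm.aestronglyMeasurable with hv
  have hvx : v =ᵐ[μ] fun x => ⨅ n, (u n : α →ₘ[μ] ℝ) x := AEEqFun.coeFn_mk _ _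
  have hle : ∀ᵐ x ∂μ, ∀ n, v x ≤ (u n : α →ₘ[μ] ℝ) x := by
    filter_upwards [h0, hvx] with x h0 hvx n
    rw [hvx]
    exact ciInf_le ⟨0, by rintro _ ⟨m, rfl⟩; exact h0 m⟩ n
  have hv0 : ∀ᵐ x ∂μ, 0 ≤ v x := by
    filter_upwards [h0, hvx] with x h0 hvx
    rw [hvx]
    exact le_ciInf h0
  have hmem : v ∈ X.carrier := by
    refine X.mem_of_ae_le (u 0).2 ?_
    filter_upwards [hle, hv0] with x h2 h3
    rw [abs_of_nonneg h3]
    exact (h2 0).trans (le_abs_self _)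
  have hlb : (⟨v, hmem⟩ : X.carrier) ∈ lowerBounds (range u) := by
    rintro _ ⟨n, rfl⟩
    refine AEEqFun.coeFn_le.1 ?_
    filter_upwards [hle] with x hx using hx n
  have hv00 : v ≤ 0 := hglb.2 hlb
  filter_upwards [h0, h1, hvx, AEEqFun.coeFn_le.2 hv00, hv0,
    AEEqFun.coeFn_zero (μ := μ) (β := ℝ) (α := α)] with x h0 h1 hvx h2 h3 h4
  have hz : ⨅ n, (u n : α →ₘ[μ] ℝ) x = 0 := by
    rw [← hvx]
    rw [h4] at h2
    exact le_antisymm h2 h3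
  rw [← hz]
  exact tendsto_atTop_ciInf (antitone_nat_of_succ_le h1) ⟨0, by rintro _ ⟨m, rfl⟩; exact h0 m⟩

lemma isGLB_zero_of_ae_tendsto {u : ℕ → X.carrier} (hu : ∀ n, 0 ≤ u n)
    (hlim : ∀ᵐ x ∂μ, Tendsto (fun n => (u n : α →ₘ[μ] ℝ) x) atTop (𝓝 0)) :
    IsGLB (range u) 0 := by
  refine ⟨by rintro _ ⟨n, rfl⟩; exact hu n, fun w hw => ?_⟩
  have h : ∀ᵐ x ∂μ, ∀ n, (w : α →ₘ[μ] ℝ) x ≤ (u n : α →ₘ[μ] ℝ) x :=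
    ae_all_iff.2 fun n => AEEqFun.coeFn_le.2 (hw ⟨n, rfl⟩)
  refine AEEqFun.coeFn_le.1 ?_
  filter_upwards [h, hlim, AEEqFun.coeFn_zero (μ := μ) (β := ℝ) (α := α)] with x h1 h2 h3
  change _ ≤ (0 : α →ₘ[μ] ℝ) x
  rw [h3]
  exact ge_of_tendsto' h2 h1

/-- Order continuity of `g`, for the pieces of `g` on a decreasing sequence of sets with null
intersection. -/
lemma tendsto_norm_cut_of_mem {g : X.carrier} (hg : g ∈ X.orderContinuousPart)
    {A : ℕ → Set α} (hA : ∀ n, MeasurableSet (A n)) (hanti : Antitone A)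
    (hnull : ∀ᵐ x ∂μ, ∃ n, x ∉ A n) :
    Tendsto (fun n => X.norm (X.cut g (A n) (hA n))) atTop (𝓝 0) := by
  have hmem : ∀ n, |(X.cut g (A n) (hA n) : α →ₘ[μ] ℝ)| ∈ X.carrier := fun n =>
    X.mem_of_ae_le (X.cut g (A n) (hA n)).2 ((ae_abs_abs _).mono fun _ h => h.le)
  set u : ℕ → X.carrier := fun n => ⟨|(X.cut g (A n) (hA n) : α →ₘ[μ] ℝ)|, hmem n⟩ with hu
  have hux : ∀ᵐ x ∂μ, ∀ n, (u n : α →ₘ[μ] ℝ) x = (A n).indicator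
      (fun x => |(g : α →ₘ[μ] ℝ) x|) x := by
    refine ae_all_iff.2 fun n => ?_
    filter_upwards [AEEqFun.coeFn_abs (X.cut g (A n) (hA n) : α →ₘ[μ] ℝ),
      X.coeFn_cut g (hA n)] with x h1 h2
    change |(X.cut g (A n) (hA n) : α →ₘ[μ] ℝ)| x = _
    rw [h1, h2]
    by_cases hx : x ∈ A n <;> simp [hx]
  have h0 : ∀ n, 0 ≤ u n := fun n => by
    rw [X.nonneg_iff_ae]
    filter_upwards [hux] with x hx
    rw [hx n]
    exact indicator_nonneg (fun _ _ => abs_nonneg _) _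
  have key := hg u (fun n => ⟨h0 n, ?_⟩) (fun n => ?_) (X.isGLB_zero_of_ae_tendsto h0 ?_)
  · refine key.congr fun n => le_antisymm (X.norm_le_of_ae_le ?_) (X.norm_le_of_ae_le ?_)
    · exact (ae_abs_abs _).mono fun _ h => h.le
    · exact (ae_abs_abs _).mono fun _ h => h.ge
  · rw [le_abs_iff_ae]
    filter_upwards [hux] with x hx
    rw [hx n]
    exact indicator_le_self' (fun _ _ => abs_nonneg _) _
  · refine AEEqFun.coeFn_le.1 ?_
    filter_upwards [hux] with x hx
    rw [hx n, hx (n + 1)]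
    exact indicator_le_indicator_of_subset (hanti n.le_succ) (fun _ => abs_nonneg _) _
  · filter_upwards [hux, hnull] with x hx ⟨m, hm⟩
    refine tendsto_const_nhds.congr' ?_
    filter_upwards [eventually_ge_atTop m] with n hn
    rw [hx n, indicator_of_notMem fun h => hm (hanti hn h)]

/-- The class of the indicator function of `A`. -/
noncomputable def _root_.indicatorClass (μ : Measure α) {A : Set α} (hA : MeasurableSet A) :
    α →ₘ[μ] ℝ :=
  AEEqFun.mk (A.indicator fun _ => (1 : ℝ)) (measurable_const.indicator hA).aestronglyMeasurable

lemma _root_.coeFn_indicatorClass {A : Set α} (hA : MeasurableSet A) :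
    indicatorClass μ hA =ᵐ[μ] A.indicator fun _ => (1 : ℝ) :=
  AEEqFun.coeFn_mk _ _

lemma _root_.distributionFun_indicatorClass_le {A : Set α} (hA : MeasurableSet A) {s : ℝ}
    (hs : 0 ≤ s) : distributionFun (indicatorClass μ hA) s ≤ μ A := by
  refine measure_mono_ae ?_
  filter_upwards [coeFn_indicatorClass (μ := μ) hA] with x hx h
  by_contra hxA
  change s < |_| at h
  rw [hx, indicator_of_notMem hxA, abs_zero] at h
  exact hs.not_gt h

lemma _root_.distributionFun_indicatorClass_of_one_le {A : Set α} (hA : MeasurableSet A) {s : ℝ}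
    (hs1 : 1 ≤ s) : distributionFun (indicatorClass μ hA) s = 0 := by
  refine measure_mono_null_ae (t := ∅) ?_ measure_empty
  filter_upwards [coeFn_indicatorClass (μ := μ) hA] with x hx h
  change s < |_| at h
  rw [hx] at h
  by_cases hxA : x ∈ A
  · rw [indicator_of_mem hxA, abs_one] at h
    exact absurd h hs1.not_gt
  · rw [indicator_of_notMem hxA, abs_zero] at h
    linarith

end BanachIdealSpace

/-! ### Domination of distribution functions in rearrangement invariant spaces -/

namespace RearrangementInvariantSpace

variable {α : Type*} [MeasurableSpace α] {μ : Measure α} (X : RearrangementInvariantSpace μ)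

lemma ae_abs_smul (c : ℝ) (f : α →ₘ[μ] ℝ) : ∀ᵐ x ∂μ, |(c • f) x| = |c| * |f x| := by
  filter_upwards [AEEqFun.coeFn_smul c f] with x hx
  rw [hx, Pi.smul_apply, smul_eq_mul, abs_mul]

/-- If every level set of `f` had infinite measure, `f` and `2 f` would be equimeasurable. -/
lemma exists_distributionFun_lt_top (f : X.carrier) :
    ∃ s, distributionFun (f : α →ₘ[μ] ℝ) s < ∞ := by
  by_contra! h
  have h' : ∀ s, distributionFun (f : α →ₘ[μ] ℝ) s = ∞ := fun s => top_le_iff.1 (h s)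
  have heq : Equimeasurable (f : α →ₘ[μ] ℝ) (((2 : ℝ) • f : X.carrier) : α →ₘ[μ] ℝ) := by
    intro s hs
    rw [h' s, eq_comm, ← top_le_iff, ← h' s]
    refine measure_mono_ae ?_
    filter_upwards [ae_abs_smul 2 (f : α →ₘ[μ] ℝ)] with x hx (hs : s < |_|)
    change s < |((2 : ℝ) • (f : α →ₘ[μ] ℝ)) x|
    rw [hx, abs_two]
    linarith [abs_nonneg ((f : α →ₘ[μ] ℝ) x)]
  have hn := X.rearrangement_norm f _ heq
  rw [map_smul_eq_mul, Real.norm_two] at hn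
  have hf : f = 0 := X.eq_zero_of_norm_eq_zero f (by linarith)
  have h0 : distributionFun (f : α →ₘ[μ] ℝ) 0 = 0 := by
    refine measure_mono_null_ae (t := ∅) ?_ measure_empty
    filter_upwards [AEEqFun.coeFn_zero (μ := μ) (β := ℝ) (α := α)] with x hx (hs : 0 < |_|)
    rw [hf] at hs
    change 0 < |(0 : α →ₘ[μ] ℝ) x| at hs
    simp [hx] at hs
  rw [h'] at h0
  exact ENNReal.top_ne_zero h0

variable {τ : α → ℝ≥0} {ρ σ : ℕ → ℝ≥0}

lemma starAlong_mem (C : IsCoordinate μ τ ρ σ) (f : X.carrier) :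
    starAlong τ C.measurable (f : α →ₘ[μ] ℝ) ∈ X.carrier :=
  X.rearrangement_mem _ _
    (C.equimeasurable_starAlong _ (X.exists_distributionFun_lt_top f)) f.2

/-- Membership and norm are monotone in the distribution function. -/
lemma mem_and_norm_le_of_distributionFun_le (C : IsCoordinate μ τ ρ σ) {f : α →ₘ[μ] ℝ}
    (g : X.carrier)
    (h : ∀ s, 0 ≤ s → distributionFun f s ≤ distributionFun (g : α →ₘ[μ] ℝ) s) :
    ∃ hf : f ∈ X.carrier, X.norm ⟨f, hf⟩ ≤ X.norm g := by
  have hg := X.exists_distributionFun_lt_top g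
  have hf : ∃ s, distributionFun f s < ∞ := by
    obtain ⟨s, hs, hd⟩ := exists_distributionFun_lt _ hg ENNReal.zero_lt_top
    exact ⟨s, (h s hs.le).trans_lt hd⟩
  have hle : ∀ᵐ x ∂μ, |starAlong τ C.measurable f x| ≤
      |starAlong τ C.measurable (g : α →ₘ[μ] ℝ) x| := by
    filter_upwards [coeFn_starAlong C.measurable f,
      coeFn_starAlong C.measurable (g : α →ₘ[μ] ℝ),
      C.ae_rearrangement_lt_top _ hg] with x h1 h2 h3
    rw [h1, h2, abs_of_nonneg ENNReal.toReal_nonneg, abs_of_nonneg ENNReal.toReal_nonneg]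
    exact ENNReal.toReal_mono h3.ne (rearrangement_mono_of_distributionFun_le h _)
  have hgs := X.starAlong_mem C g
  have hfs := X.mem_of_ae_le hgs hle
  have ef := C.equimeasurable_starAlong f hf
  have hfm := X.rearrangement_mem _ _ ef.symm hfs
  refine ⟨hfm, ?_⟩
  rw [X.rearrangement_norm ⟨f, hfm⟩ ⟨_, hfs⟩ ef,
    X.rearrangement_norm g ⟨_, hgs⟩ (C.equimeasurable_starAlong _ hg)]
  exact X.norm_le_of_ae_le hle

lemma norm_le_of_distributionFun_le (C : IsCoordinate μ τ ρ σ) {f g : X.carrier}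
    (h : ∀ s, 0 ≤ s →
      distributionFun (f : α →ₘ[μ] ℝ) s ≤ distributionFun (g : α →ₘ[μ] ℝ) s) :
    X.norm f ≤ X.norm g :=
  (X.mem_and_norm_le_of_distributionFun_le C g h).2

/-- Sets of measure smaller than the whole space have their indicator in `X`: compare with a
level set of the weak unit. -/
lemma indicatorClass_mem_of_lt (C : IsCoordinate μ τ ρ σ) {B : Set α} (hB : MeasurableSet B)
    (h : μ B < μ univ) : indicatorClass μ hB ∈ X.carrier := by
  obtain ⟨u, hu, hpos⟩ := X.exists_weakUnit
  have h0 : μ B < distributionFun u 0 := by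
    refine h.trans_le (measure_mono_ae ?_)
    filter_upwards [hpos] with x hx _
    exact hx.trans_le (le_abs_self _)
  obtain ⟨c, hc, hBc⟩ := exists_gt_lt_distributionFun u h0
  refine (X.mem_and_norm_le_of_distributionFun_le C (c⁻¹ • ⟨u, hu⟩ : X.carrier)
    fun s hs => ?_).1
  rcases lt_or_ge s 1 with hs1 | hs1
  · refine (distributionFun_indicatorClass_le hB hs).trans (hBc.le.trans (measure_mono_ae ?_))
    filter_upwards [ae_abs_smul c⁻¹ u] with x hx (hcx : c < |_|)
    change s < |(c⁻¹ • u) x|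
    rw [hx, abs_of_pos (inv_pos.2 hc)]
    refine hs1.trans ?_
    rw [inv_mul_eq_div, one_lt_div hc]
    exact hcx
  · rw [distributionFun_indicatorClass_of_one_le hB hs1]
    exact zero_le

lemma indicatorClass_mem (C : IsCoordinate μ τ ρ σ) {B : Set α} (hB : MeasurableSet B)
    (h : μ B < ∞) : indicatorClass μ hB ∈ X.carrier := by
  obtain ⟨S, hS, hsplit⟩ := C.split
  have h1 := X.indicatorClass_mem_of_lt C (hB.inter hS) (hsplit B h).1
  have h2 := X.indicatorClass_mem_of_lt C (hB.diff hS) (hsplit B h).2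
  refine X.mem_of_ae_le (X.carrier.add_mem h1 h2) ?_
  filter_upwards [coeFn_indicatorClass (μ := μ) hB, coeFn_indicatorClass (μ := μ) (hB.inter hS),
    coeFn_indicatorClass (μ := μ) (hB.diff hS),
    AEEqFun.coeFn_add (indicatorClass μ (hB.inter hS)) (indicatorClass μ (hB.diff hS))]
    with x e1 e2 e3 e4
  rw [e4, Pi.add_apply, e1, e2, e3]
  by_cases hx : x ∈ B <;> by_cases hxS : x ∈ S <;> simp [hx, hxS]

/-- The fundamental function of `X` vanishes at zero: sets of small measure have indicators of
small norm. -/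
def FundamentalVanishes (X : RearrangementInvariantSpace μ) : Prop :=
  ∀ ε : ℝ, 0 < ε → ∃ δ : ℝ≥0∞, 0 < δ ∧ ∀ (A : Set α) (hA : MeasurableSet A), μ A < δ →
    ∃ h : indicatorClass μ hA ∈ X.carrier, X.norm ⟨_, h⟩ < ε

/-- Bounded functions supported on a set of finite measure are order continuous. -/
lemma mem_orderContinuousPart_of_bounded (C : IsCoordinate μ τ ρ σ) (hX : X.FundamentalVanishes)
    (f : X.carrier) {B : Set α} (hB : MeasurableSet B) (hBfin : μ B < ∞) (M : ℝ)
    (hf : ∀ᵐ x ∂μ, |(f : α →ₘ[μ] ℝ) x| ≤ B.indicator (fun _ => M) x) :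
    f ∈ X.orderContinuousPart := by
  intro u hu hanti hglb
  have hlim := X.ae_tendsto_zero_of_isGLB (fun n => (hu n).1) hanti hglb
  have hBm := X.indicatorClass_mem C hB hBfin
  set b : X.carrier := ⟨_, hBm⟩ with hb
  have hu0 : ∀ n, ∀ᵐ x ∂μ, 0 ≤ (u n : α →ₘ[μ] ℝ) x := fun n => X.nonneg_iff_ae.1 (hu n).1
  have huf : ∀ n, ∀ᵐ x ∂μ, (u n : α →ₘ[μ] ℝ) x ≤ B.indicator (fun _ => M) x := fun n => by
    filter_upwards [BanachIdealSpace.le_abs_iff_ae.1 (hu n).2, hf] with x h1 h2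
      using h1.trans h2
  have hmeas : ∀ (n : ℕ) (η : ℝ), MeasurableSet (B ∩ {x | η < (u n : α →ₘ[μ] ℝ) x}) :=
    fun n η => hB.inter (measurableSet_lt measurable_const (u n : α →ₘ[μ] ℝ).measurable)
  have hmu : ∀ η : ℝ, 0 < η →
      Tendsto (fun n => μ (B ∩ {x | η < (u n : α →ₘ[μ] ℝ) x})) atTop (𝓝 0) := by
    intro η hη
    have : Tendsto (fun n => μ (B ∩ {x | η < (u n : α →ₘ[μ] ℝ) x})) atTop (𝓝 (μ ∅)) := by
      refine tendsto_measure_of_ae_tendsto_indicator atTop MeasurableSet.empty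
        (fun n => hmeas n η) hB hBfin.ne (Eventually.of_forall fun n => inter_subset_left) ?_
      filter_upwards [hlim] with x hx
      filter_upwards [hx.eventually (gt_mem_nhds hη)] with n hn
      simp [hn.le]
    simpa using this
  -- Split `u n` at height `η`: below it is at most `η χ_B`, above it lives on a small set.
  have hbound : ∀ (η : ℝ), 0 < η → ∀ n (h : indicatorClass μ (hmeas n η) ∈ X.carrier),
      X.norm (u n) ≤ η * X.norm b + |M| * X.norm ⟨_, h⟩ := by
    intro η hη n h
    have hle : X.norm (u n) ≤ X.norm (η • b + |M| • ⟨_, h⟩) := by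
      refine X.norm_le_of_ae_le ?_
      filter_upwards [hu0 n, huf n, X.coeFn_carrier_add (η • b) (|M| • ⟨_, h⟩),
        X.coeFn_carrier_smul η b, X.coeFn_carrier_smul |M| ⟨_, h⟩,
        coeFn_indicatorClass (μ := μ) hB, coeFn_indicatorClass (μ := μ) (hmeas n η)]
        with x h1 h2 h3 h4 h5 h6 h7
      rw [h3, h4, h5]
      change _ ≤ |η * (indicatorClass μ hB) x + |M| * (indicatorClass μ (hmeas n η)) x|
      rw [h6, h7, abs_of_nonneg h1]
      refine le_trans ?_ (le_abs_self _)
      by_cases hx : x ∈ B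
      · rw [indicator_of_mem hx] at h2 ⊢
        by_cases hx' : η < (u n : α →ₘ[μ] ℝ) x
        · rw [indicator_of_mem (show x ∈ B ∩ {x | η < (u n : α →ₘ[μ] ℝ) x} from ⟨hx, hx'⟩)]
          linarith [le_abs_self M]
        · rw [indicator_of_notMem fun h => hx' h.2]
          linarith
      · rw [indicator_of_notMem hx] at h2 ⊢
        rw [indicator_of_notMem fun h => hx h.1]
        linarith
    refine hle.trans ((map_add_le_add _ _ _).trans ?_)
    rw [map_smul_eq_mul, map_smul_eq_mul, Real.norm_of_nonneg hη.le,
      Real.norm_of_nonneg (abs_nonneg M)]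
  rw [Metric.tendsto_atTop]
  intro ε hε
  have hb0 : 0 ≤ X.norm b := apply_nonneg _ _
  obtain ⟨δ, hδ, hδA⟩ := hX (ε / 2 / (|M| + 1)) (by positivity)
  have hη : 0 < ε / 2 / (X.norm b + 1) := by positivity
  obtain ⟨N, hN⟩ := eventually_atTop.1 ((hmu _ hη).eventually (gt_mem_nhds hδ))
  refine ⟨N, fun n hn => ?_⟩
  obtain ⟨hm, hlt⟩ := hδA _ (hmeas n _) (hN n hn)
  have h1 := hbound _ hη n hm
  rw [dist_zero_right, Real.norm_of_nonneg (apply_nonneg _ _)]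
  have h2 : ε / 2 / (X.norm b + 1) * X.norm b ≤ ε / 2 := by
    rw [div_mul_eq_mul_div, div_le_iff₀ (by positivity)]
    nlinarith
  have h3 : |M| * (ε / 2 / (|M| + 1)) < ε / 2 := by
    rw [mul_div_assoc', div_lt_iff₀ (by positivity)]
    nlinarith [abs_nonneg M]
  have h4 := mul_le_mul_of_nonneg_left hlt.le (abs_nonneg M)
  linarith

end RearrangementInvariantSpace

/-! ### The two estimates for the distance -/

namespace RearrangementInvariantSpace

variable {α : Type*} [MeasurableSpace α] {μ : Measure α} (X : RearrangementInvariantSpace μ)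
variable {τ : α → ℝ≥0} {ρ σ : ℕ → ℝ≥0}

lemma distTo_le_norm_sub (f : X.carrier) {M : Set X.carrier} {g : X.carrier} (hg : g ∈ M) :
    X.distTo f M ≤ X.norm (f - g) :=
  csInf_le ⟨0, by rintro _ ⟨h, -, rfl⟩; exact apply_nonneg _ _⟩ ⟨g, hg, rfl⟩

lemma distributionFun_cut (f : X.carrier) {S : Set α} (hS : MeasurableSet S) {s : ℝ}
    (hs : 0 ≤ s) : distributionFun (X.cut f S hS : α →ₘ[μ] ℝ) s =
      μ {x | s < |(f : α →ₘ[μ] ℝ) x| ∧ x ∈ S} := by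
  refine measure_congr ?_
  filter_upwards [X.coeFn_cut f hS] with x hx
  refine propext ?_
  change s < |_| ↔ _ ∧ x ∈ S
  rw [hx]
  by_cases hxS : x ∈ S
  · simp [hxS]
  · simp [hxS, hs]

lemma distributionFun_cut_starAlong (C : IsCoordinate μ τ ρ σ) (f : X.carrier) {O : Set α}
    (hO : MeasurableSet O) {n : ℕ} (hOn : ∀ᵐ x ∂μ, x ∈ O ↔ τ x < ρ n ∨ σ n ≤ τ x) {s : ℝ}
    (hs : 0 ≤ s) :
    distributionFun (X.cut ⟨_, X.starAlong_mem C f⟩ O hO : α →ₘ[μ] ℝ) s =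
      μ {x | (τ x : ℝ≥0∞) < distributionFun (f : α →ₘ[μ] ℝ) s ∧ (τ x < ρ n ∨ σ n ≤ τ x)} := by
  rw [X.distributionFun_cut _ hO hs]
  refine measure_congr ?_
  filter_upwards [hOn, C.ae_lt_abs_starAlong _ (X.exists_distributionFun_lt_top f)] with x h1 h2
  refine propext ?_
  change (s < |_| ∧ x ∈ O) ↔ _
  rw [h1, h2 s hs]
  rfl

/-- If the rearrangement of `f` at `t` is `c`, then `|f| ≥ c` on a set of measure at least `t`. -/
lemma le_measure_rearrangement_le (f : α →ₘ[μ] ℝ) {t : ℝ≥0} (ht : rearrangement f t < ∞) {s : ℝ}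
    (hs : 0 ≤ s) (hsc : s < (rearrangement f t).toReal) (hfin : distributionFun f s < ∞) :
    (t : ℝ≥0∞) ≤ μ {x | (rearrangement f t).toReal ≤ |f x|} := by
  set c := (rearrangement f t).toReal with hc
  have hpos : ∀ k : ℕ, 0 < (c - s) * (1 / ((k : ℝ) + 1)) := fun k =>
    mul_pos (sub_pos.2 hsc) Nat.one_div_pos_of_nat
  have hle : ∀ k : ℕ, (c - s) * (1 / ((k : ℝ) + 1)) ≤ c - s := fun k => by
    have h1 : 1 / ((k : ℝ) + 1) ≤ 1 := by
      rw [div_le_one (by positivity)]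
      linarith [k.cast_nonneg (α := ℝ)]
    exact mul_le_of_le_one_right (sub_pos.2 hsc).le h1
  have hanti : Antitone fun k : ℕ => {x | c - (c - s) * (1 / ((k : ℝ) + 1)) < |f x|} := by
    intro m n hmn x (hx : c - (c - s) * (1 / ((n : ℝ) + 1)) < |f x|)
    refine lt_of_le_of_lt ?_ hx
    have := mul_le_mul_of_nonneg_left (Nat.one_div_le_one_div (α := ℝ) hmn) (sub_pos.2 hsc).le
    linarith
  have hI : (⋂ k : ℕ, {x | c - (c - s) * (1 / ((k : ℝ) + 1)) < |f x|}) = {x | c ≤ |f x|} := by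
    ext x
    simp only [mem_iInter, mem_ofPred_eq]
    constructor
    · intro h
      have h1 : Tendsto (fun k : ℕ => c - (c - s) * (1 / ((k : ℝ) + 1))) atTop
          (𝓝 (c - (c - s) * 0)) :=
        tendsto_const_nhds.sub (tendsto_const_nhds.mul tendsto_one_div_add_atTop_nhds_zero_nat)
      rw [mul_zero, sub_zero] at h1
      exact le_of_tendsto' h1 fun k => (h k).le
    · intro h k
      linarith [hpos k]
  have ht' := tendsto_measure_iInter_atTop (μ := μ)
    (fun k : ℕ => (measurableSet_lt_abs f (c - (c - s) * (1 / ((k : ℝ) + 1)))).nullMeasurableSet)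
    hanti ⟨0, ((distributionFun_anti f (by linarith [hle 0])).trans_lt hfin).ne⟩
  rw [hI] at ht'
  refine ge_of_tendsto' ht' fun k => ?_
  exact ((lt_toReal_rearrangement f (by linarith [hle k]) ht).1 (by linarith [hpos k])).le

/-- The upper bound: removing from `f` its part on the finite-measure set
`{c ≤ |f|, a < |f| ≤ D}`, where `c = f*(σ n)`, `D = f*(ρ n)` and `a = f*(∞)`, leaves a function
whose distribution function is dominated by that of `f* χ_{O n}`. -/
lemma distTo_le_norm_cut_starAlong (C : IsCoordinate μ τ ρ σ) (hX : X.FundamentalVanishes)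
    (f : X.carrier) {O : Set α}
    (hO : MeasurableSet O) {n : ℕ} (hOn : ∀ᵐ x ∂μ, x ∈ O ↔ τ x < ρ n ∨ σ n ≤ τ x) :
    X.distTo f X.orderContinuousPart ≤ X.norm (X.cut ⟨_, X.starAlong_mem C f⟩ O hO) := by
  have hfin := X.exists_distributionFun_lt_top f
  have hρ := (C.isThreshold n).rearrangement_lt_top (f : α →ₘ[μ] ℝ) hfin
  have hσ := ((C.isThreshold n).mono (C.le n)).rearrangement_lt_top (f : α →ₘ[μ] ℝ) hfin
  set F : α →ₘ[μ] ℝ := (f : α →ₘ[μ] ℝ) with hF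
  set D := (rearrangement F (ρ n)).toReal with hD
  set c := (rearrangement F (σ n)).toReal with hc
  have hD0 : 0 ≤ D := ENNReal.toReal_nonneg
  have hc0 : 0 ≤ c := ENNReal.toReal_nonneg
  set a := sInf {s | 0 ≤ s ∧ distributionFun F s < ∞} with ha
  have hne : {s | 0 ≤ s ∧ distributionFun F s < ∞}.Nonempty := by
    obtain ⟨s, hs, hd⟩ := exists_distributionFun_lt F hfin ENNReal.zero_lt_top
    exact ⟨s, hs.le, hd⟩
  have hale : ∀ s, 0 ≤ s → distributionFun F s < ∞ → a ≤ s := fun s hs hd =>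
    csInf_le ⟨0, fun r hr => hr.1⟩ ⟨hs, hd⟩
  have halt : ∀ r, a < r → distributionFun F r < ∞ := fun r hr => by
    obtain ⟨s, hs, hsr⟩ := exists_lt_of_csInf_lt hne hr
    exact (distributionFun_anti F hsr.le).trans_lt hs.2
  have hFm : Measurable fun x => |F x| := F.measurable.abs
  set E : Set α := {x | c ≤ |F x|} ∩ {x | a < |F x|} ∩ {x | |F x| ≤ D} with hE
  have hEm : MeasurableSet E := ((measurableSet_le measurable_const hFm).inter
    (measurableSet_lt measurable_const hFm)).inter (measurableSet_le hFm measurable_const)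
  have hEfin : μ E < ∞ := by
    rcases lt_or_ge a c with hac | hca
    · obtain ⟨r, har, hrc⟩ := exists_between hac
      refine (measure_mono ?_).trans_lt (halt r har)
      exact fun x hx => lt_of_lt_of_le hrc hx.1.1
    · refine (measure_mono (t := {x | c < |F x|}) ?_).trans_lt
        ((distributionFun_rearrangement_le F hσ).trans_lt ENNReal.coe_lt_top)
      exact fun x hx => lt_of_le_of_lt hca hx.1.2
  have hmem : X.cut f E hEm ∈ X.orderContinuousPart := by
    refine X.mem_orderContinuousPart_of_bounded C hX _ hEm hEfin D ?_
    filter_upwards [X.coeFn_cut f hEm] with x hx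
    rw [hx]
    by_cases hxE : x ∈ E
    · rw [indicator_of_mem hxE, indicator_of_mem hxE]
      exact hxE.2
    · rw [indicator_of_notMem hxE, indicator_of_notMem hxE, abs_zero]
  refine (X.distTo_le_norm_sub f hmem).trans ?_
  have hsub : X.norm (f - X.cut f E hEm) ≤ X.norm (X.cut f Eᶜ hEm.compl) := by
    refine X.norm_le_of_ae_le ?_
    filter_upwards [X.coeFn_carrier_sub f (X.cut f E hEm), X.coeFn_cut f hEm,
      X.coeFn_cut f hEm.compl] with x h1 h2 h3
    rw [h1, h2, h3]
    by_cases hxE : x ∈ E <;> simp [hxE]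
  refine hsub.trans (X.norm_le_of_distributionFun_le C fun s hs => ?_)
  rw [X.distributionFun_cut f hEm.compl hs, X.distributionFun_cut_starAlong C f hO hOn hs]
  have hτ := C.measurable
  have hτlt : ∀ t : ℝ≥0, MeasurableSet {x | τ x < t} := fun t =>
    measurableSet_lt hτ measurable_const
  have hτlt' : ∀ b : ℝ≥0∞, MeasurableSet {x | (τ x : ℝ≥0∞) < b} := fun b =>
    measurableSet_lt hτ.coe_nnreal_ennreal measurable_const
  rcases eq_or_ne (distributionFun F s) ∞ with htop | hs_ne
  · -- Here `f* > s` everywhere, and the far part of the coordinate has infinite measure.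
    have h1 : (∞ : ℝ≥0∞) ≤ μ {x | τ x < σ n} + μ {x | σ n ≤ τ x} := by
      rw [← htop]
      refine le_trans (measure_mono fun x _ => ?_) (measure_union_le _ _)
      exact lt_or_ge (τ x) (σ n)
    have h2 : μ {x | σ n ≤ τ x} = ∞ := by
      rcases ENNReal.add_eq_top.1 (top_le_iff.1 h1) with h | h
      · exact absurd h (C.measure_lt_top n).ne
      · exact h
    rw [htop]
    refine le_top.trans (h2.ge.trans (measure_mono fun x hx => ⟨?_, Or.inr hx⟩))
    exact ENNReal.coe_lt_top
  have hsfin : distributionFun F s < ∞ := lt_top_iff_ne_top.2 hs_ne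
  have hsa := hale s hs hsfin
  have hcover : {x | s < |F x| ∧ x ∈ Eᶜ} ⊆
      {x | max s D < |F x|} ∪ ({x | s < |F x|} \ {x | c ≤ |F x|}) := by
    rintro x ⟨hx, hxE⟩
    by_cases h1 : D < |F x|
    · exact Or.inl (max_lt hx h1)
    · refine Or.inr ⟨hx, fun h => hxE ⟨⟨h, hsa.trans_lt hx⟩, not_lt.1 h1⟩⟩
  have hsplit : {x | (τ x : ℝ≥0∞) < distributionFun F (max s D)} ∪
      ({x | (τ x : ℝ≥0∞) < distributionFun F s} \ {x | τ x < σ n}) ⊆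
      {x | (τ x : ℝ≥0∞) < distributionFun F s ∧ (τ x < ρ n ∨ σ n ≤ τ x)} := by
    have hmaxρ : distributionFun F (max s D) ≤ ρ n :=
      (distributionFun_anti F (le_max_right s D)).trans (distributionFun_rearrangement_le F hρ)
    rintro x (hx | hx)
    · refine ⟨lt_of_lt_of_le hx (distributionFun_anti F (le_max_left s D)), Or.inl ?_⟩
      exact_mod_cast lt_of_lt_of_le hx hmaxρ
    · exact ⟨hx.1, Or.inr (not_lt.1 hx.2)⟩
  have hdisj : Disjoint {x | (τ x : ℝ≥0∞) < distributionFun F (max s D)}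
      ({x | (τ x : ℝ≥0∞) < distributionFun F s} \ {x | τ x < σ n}) := by
    rw [Set.disjoint_left]
    intro x hx hx'
    refine hx'.2 ?_
    have hmaxρ : distributionFun F (max s D) ≤ σ n :=
      ((distributionFun_anti F (le_max_right s D)).trans
        (distributionFun_rearrangement_le F hρ)).trans (by exact_mod_cast C.le n)
    have := lt_of_lt_of_le hx hmaxρ
    exact_mod_cast this
  refine (measure_mono hcover).trans ((measure_union_le _ _).trans (le_trans ?_
    (measure_mono hsplit)))
  rw [measure_union hdisj ((hτlt' _).diff (hτlt _)), C.measure_lt_distributionFun]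
  refine add_le_add le_rfl ?_
  rcases lt_or_ge s c with hsc | hcs
  · -- Both sides are `d_f(s)` minus the measure of a set, and `{τ < σ n}` is the smaller set.
    have hσle := le_measure_rearrangement_le F hσ hs hsc hsfin
    have hcm : MeasurableSet {x | c ≤ |F x|} := measurableSet_le measurable_const hFm
    have hcs : {x | c ≤ |F x|} ⊆ {x | s < |F x|} := fun x hx => lt_of_lt_of_le hsc hx
    have hcfin : μ {x | c ≤ |F x|} ≠ ∞ := ((measure_mono hcs).trans_lt hsfin).ne
    have hle : μ {x | τ x < σ n} ≤ μ {x | c ≤ |F x|} := by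
      rw [← C.measure_lt _ hcm]
      refine measure_mono fun x (hx : τ x < σ n) => lt_of_lt_of_le ?_ hσle
      exact_mod_cast hx
    rw [measure_sdiff hcs hcm.nullMeasurableSet hcfin]
    refine le_trans ?_ le_measure_sdiff
    rw [C.measure_lt_distributionFun]
    exact tsub_le_tsub_left hle _
  · have : {x | s < |F x|} \ {x | c ≤ |F x|} = ∅ :=
      sdiff_eq_empty.2 fun x (hx : s < |F x|) => hcs.trans hx.le
    rw [this, measure_empty]
    exact zero_le

/-- The key estimate for the lower bound: if `f` and `h` differ by a function bounded by `k` and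
supported on `B`, then `(f* - k)⁺ χ_{τ < ρ n} + f* χ_{σ n ≤ τ}` has a distribution function
dominated by that of `h`, as soon as the sublevel set `{τ < σ n}` is larger than `B` by one unit. -/
lemma norm_cut_starAlong_le (C : IsCoordinate μ τ ρ σ) (f h : X.carrier) {k : ℝ} (hk : 0 ≤ k)
    {B : Set α} (hfh : ∀ᵐ x ∂μ, |(f : α →ₘ[μ] ℝ) x| ≤ |(h : α →ₘ[μ] ℝ) x| + k)
    (hB : ∀ᵐ x ∂μ, x ∉ B → |(f : α →ₘ[μ] ℝ) x| ≤ |(h : α →ₘ[μ] ℝ) x|)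
    {O : Set α} (hO : MeasurableSet O) {n : ℕ}
    (hOn : ∀ᵐ x ∂μ, x ∈ O ↔ τ x < ρ n ∨ σ n ≤ τ x)
    (hS : MeasurableSet {x | τ x < ρ n}) (hSX : indicatorClass μ hS ∈ X.carrier)
    (hρ1 : μ {x | τ x < ρ n} ≤ 1)
    (htail : 1 + μ B ≤ μ {x | τ x < σ n} ∨ μ {x | σ n ≤ τ x} = 0) :
    X.norm (X.cut ⟨_, X.starAlong_mem C f⟩ O hO) ≤ X.norm h + k * X.norm ⟨_, hSX⟩ := by
  have hfin := X.exists_distributionFun_lt_top f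
  set F : α →ₘ[μ] ℝ := (f : α →ₘ[μ] ℝ) with hF
  set H : α →ₘ[μ] ℝ := (h : α →ₘ[μ] ℝ) with hH
  have hτ := C.measurable
  have hτlt : ∀ t : ℝ≥0, MeasurableSet {x | τ x < t} := fun t =>
    measurableSet_lt hτ measurable_const
  have hτle : ∀ t : ℝ≥0, MeasurableSet {x | t ≤ τ x} := fun t =>
    measurableSet_le measurable_const hτ
  set r : α → ℝ := fun x => (rearrangement F (τ x)).toReal with hr
  have hr0 : ∀ x, 0 ≤ r x := fun x => ENNReal.toReal_nonneg
  have hrm : Measurable r :=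
    ((antitone_rearrangement F).measurable.comp hτ.coe_nnreal_real).ennreal_toReal
  set v : α → ℝ := fun x => {x | τ x < ρ n}.indicator (fun x => max (r x - k) 0) x +
    {x | σ n ≤ τ x}.indicator r x with hv
  have hvm : Measurable v :=
    (((hrm.sub_const k).max measurable_const).indicator (hτlt _)).add (hrm.indicator (hτle _))
  have hv1 : ∀ x, τ x < ρ n → v x = max (r x - k) 0 := fun x hx => by
    have : ¬ σ n ≤ τ x := not_le.2 (hx.trans_le (C.le n))
    simp [hv, hx, this]
  have hv2 : ∀ x, σ n ≤ τ x → v x = r x := fun x hx => by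
    have : ¬ τ x < ρ n := not_lt.2 ((C.le n).trans hx)
    simp [hv, hx, this]
  have hv3 : ∀ x, ¬ τ x < ρ n → ¬ σ n ≤ τ x → v x = 0 := fun x h1 h2 => by
    simp only [hv]
    rw [indicator_of_notMem (by exact h1), indicator_of_notMem (by exact h2), add_zero]
  set u : α →ₘ[μ] ℝ := AEEqFun.mk v hvm.aestronglyMeasurable with hu
  have hux : u =ᵐ[μ] v := AEEqFun.coeFn_mk _ _
  have hd : ∀ s, 0 ≤ s → distributionFun u s ≤ distributionFun H s := by
    intro s hs
    have hd1 : distributionFun F (s + k) ≤ distributionFun H s := by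
      refine measure_mono_ae ?_
      filter_upwards [hfh] with x hx (h1 : s + k < |F x|)
      change s < |H x|
      linarith
    have hd2 : distributionFun F s ≤ distributionFun H s + μ B := by
      refine le_trans (measure_mono_ae ?_) (measure_union_le _ _)
      filter_upwards [hB] with x hx (h1 : s < |F x|)
      by_cases hxB : x ∈ B
      · exact Or.inr hxB
      · exact Or.inl (h1.trans_le (hx hxB))
    have hcover : distributionFun u s ≤
        μ ({x | (τ x : ℝ≥0∞) < distributionFun F (s + k)} ∩ {x | τ x < ρ n}) +
          μ ({x | (τ x : ℝ≥0∞) < distributionFun F s} ∩ {x | σ n ≤ τ x}) := by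
      refine le_trans (measure_mono_ae ?_) (measure_union_le _ _)
      filter_upwards [hux, C.ae_rearrangement_lt_top F hfin] with x h1 h2 (h3 : s < |u x|)
      rw [h1] at h3
      by_cases ha : τ x < ρ n
      · refine Or.inl ⟨(lt_toReal_rearrangement F (by positivity) h2).1 ?_, ha⟩
        rw [hv1 x ha, abs_of_nonneg (le_max_right _ _), lt_max_iff] at h3
        have := h3.resolve_right hs.not_gt
        change s + k < r x
        linarith
      · by_cases hb : σ n ≤ τ x
        · refine Or.inr ⟨(lt_toReal_rearrangement F hs h2).1 ?_, hb⟩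
          rwa [hv2 x hb, abs_of_nonneg (hr0 x)] at h3
        · rw [hv3 x ha hb, abs_zero] at h3
          exact absurd h3 hs.not_gt
    refine hcover.trans ?_
    have hnear : μ {x | (τ x : ℝ≥0∞) < distributionFun F (s + k)} ≤ distributionFun H s := by
      rw [C.measure_lt_distributionFun]
      exact hd1
    by_cases hcase : μ ({x | (τ x : ℝ≥0∞) < distributionFun F s} ∩ {x | σ n ≤ τ x}) = 0
    · rw [hcase, add_zero]
      exact (measure_mono inter_subset_left).trans hnear
    · -- The set `{τ < σ n}` then lies in `{τ < d_f(s)}`; adding its measure to both sides absorbs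
      -- the unit coming from the near part and the error `μ B` in `d_f ≤ d_h + μ B`.
      have hnull : μ {x | σ n ≤ τ x} ≠ 0 := fun h0 =>
        hcase (measure_mono_null inter_subset_right h0)
      have hbig := htail.resolve_right hnull
      have hσd : (σ n : ℝ≥0∞) < distributionFun F s := by
        by_contra! hle
        refine hcase (measure_mono_null (t := ∅) ?_ measure_empty)
        rintro x ⟨hx1, hx2⟩
        have h1 := lt_of_lt_of_le hx1 hle
        exact absurd hx2 (not_le.2 (by exact_mod_cast h1))
      have hsum : μ ({x | (τ x : ℝ≥0∞) < distributionFun F s} ∩ {x | σ n ≤ τ x}) +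
          μ {x | τ x < σ n} ≤ distributionFun F s := by
        rw [← measure_union _ (hτlt _)]
        · rw [← C.measure_lt_distributionFun F s]
          nth_rw 1 [C.measure_lt_distributionFun F s]
          refine measure_mono (union_subset inter_subset_left fun x (hx : τ x < σ n) => ?_)
          exact lt_trans (by exact_mod_cast hx) hσd
        · rw [Set.disjoint_left]
          exact fun x hx (hx' : τ x < σ n) => hx'.not_ge hx.2
      refine ENNReal.le_of_add_le_add_right (C.measure_lt_top n).ne ?_
      calc _ ≤ 1 + (μ ({x | (τ x : ℝ≥0∞) < distributionFun F s} ∩ {x | σ n ≤ τ x}) +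
              μ {x | τ x < σ n}) := by
            rw [add_assoc]
            exact add_le_add ((measure_mono inter_subset_right).trans hρ1) le_rfl
        _ ≤ 1 + (distributionFun H s + μ B) := add_le_add le_rfl (hsum.trans hd2)
        _ = distributionFun H s + (1 + μ B) := by ring
        _ ≤ _ := add_le_add le_rfl hbig
  obtain ⟨hum, hun⟩ := X.mem_and_norm_le_of_distributionFun_le C h hd
  have hfinal : X.norm (X.cut ⟨_, X.starAlong_mem C f⟩ O hO) ≤
      X.norm (⟨u, hum⟩ + k • ⟨_, hSX⟩) := by
    refine X.norm_le_of_ae_le ?_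
    filter_upwards [X.coeFn_cut ⟨_, X.starAlong_mem C f⟩ hO,
      X.coeFn_carrier_add ⟨u, hum⟩ (k • ⟨_, hSX⟩), X.coeFn_carrier_smul k ⟨_, hSX⟩,
      coeFn_indicatorClass (μ := μ) hS, coeFn_starAlong hτ F, hux, hOn]
      with x h1 h2 h3 h4 h5 h6 h7
    rw [h1, h2, h3]
    rw [h4, h6]
    refine le_trans ?_ (le_abs_self _)
    by_cases hxO : x ∈ O
    · rw [indicator_of_mem hxO]
      change |starAlong τ hτ F x| ≤ _
      rw [h5, abs_of_nonneg ENNReal.toReal_nonneg]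
      change r x ≤ _
      by_cases ha : τ x < ρ n
      · rw [hv1 x ha, indicator_of_mem (by exact ha)]
        linarith [le_max_left (r x - k) 0]
      · have hb := (h7.1 hxO).resolve_left ha
        rw [hv2 x hb, indicator_of_notMem (by exact ha)]
        linarith
    · rw [indicator_of_notMem hxO, abs_zero]
      refine add_nonneg (add_nonneg (indicator_nonneg (fun x _ => le_max_right _ _) _)
        (indicator_nonneg (fun x _ => hr0 x) _)) (mul_nonneg hk ?_)
      exact indicator_nonneg (fun _ _ => zero_le_one) _
  refine hfinal.trans ((map_add_le_add _ _ _).trans ?_)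
  rw [map_smul_eq_mul, Real.norm_of_nonneg hk]
  exact add_le_add hun le_rfl

end RearrangementInvariantSpace

/-! ### The distance as a limit, along a coordinate -/

namespace RearrangementInvariantSpace

variable {α : Type*} [MeasurableSpace α] {μ : Measure α} (X : RearrangementInvariantSpace μ)
variable {τ : α → ℝ≥0} {ρ σ : ℕ → ℝ≥0}

/-- The upper estimate holds for every `n`; the lower one holds up to `ε` for large `n`, once a
nearly optimal order continuous `g` has been replaced by a bounded truncation of itself. -/
theorem tendsto_norm_cut_starAlong [SigmaFinite μ] (C : IsCoordinate μ τ ρ σ)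
    (hX : X.FundamentalVanishes) (f : X.carrier) {O : ℕ → Set α}
    (hO : ∀ n, MeasurableSet (O n))
    (hOn : ∀ n, ∀ᵐ x ∂μ, x ∈ O n ↔ τ x < ρ n ∨ σ n ≤ τ x) :
    Tendsto (fun n => X.norm (X.cut ⟨_, X.starAlong_mem C f⟩ (O n) (hO n))) atTop
      (𝓝 (X.distTo f X.orderContinuousPart)) := by
  rw [Metric.tendsto_atTop]
  intro ε hε
  have h0 : (0 : X.carrier) ∈ X.orderContinuousPart := by
    refine X.mem_orderContinuousPart_of_bounded C hX 0 MeasurableSet.empty (by simp) 0 ?_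
    filter_upwards [AEEqFun.coeFn_zero (μ := μ) (β := ℝ) (α := α)] with x hx
    change |(0 : α →ₘ[μ] ℝ) x| ≤ _
    simp [hx]
  obtain ⟨_, ⟨g, hg, rfl⟩, hgd⟩ := exists_lt_of_csInf_lt
    (s := (fun g => X.norm (f - g)) '' X.orderContinuousPart)
    (b := X.distTo f X.orderContinuousPart + ε / 3) ⟨_, 0, h0, rfl⟩
    (lt_add_of_pos_right _ (by positivity))
  have hgm : Measurable fun x => |(g : α →ₘ[μ] ℝ) x| := (g : α →ₘ[μ] ℝ).measurable.abs
  -- The part of `g` where it is large, or far away in an exhaustion by sets of finite measure,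
  -- is small in norm.
  set B : ℕ → Set α := fun k => {x | |(g : α →ₘ[μ] ℝ) x| ≤ k} ∩ spanningSets μ k with hB
  have hBm : ∀ k, MeasurableSet (B k) := fun k =>
    (measurableSet_le hgm measurable_const).inter (measurableSet_spanningSets μ k)
  have hBfin : ∀ k, μ (B k) < ∞ := fun k =>
    (measure_mono inter_subset_right).trans_lt (measure_spanningSets_lt_top μ k)
  have hBmono : Monotone B := fun k l hkl => inter_subset_inter
    (fun x (hx : |(g : α →ₘ[μ] ℝ) x| ≤ k) => hx.trans (by exact_mod_cast hkl))
    (monotone_spanningSets μ hkl)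
  have hcut := X.tendsto_norm_cut_of_mem hg (A := fun k => (B k)ᶜ) (fun k => (hBm k).compl)
    (fun k l hkl => compl_subset_compl.2 (hBmono hkl)) (Eventually.of_forall fun x => by
      obtain ⟨k, hk⟩ := exists_nat_ge |(g : α →ₘ[μ] ℝ) x|
      obtain ⟨l, hl⟩ := mem_iUnion.1 ((iUnion_spanningSets μ).symm ▸ mem_univ x)
      refine ⟨max k l, fun h => h ⟨hk.trans (by exact_mod_cast le_max_left k l), ?_⟩⟩
      exact monotone_spanningSets μ (le_max_right k l) hl)
  obtain ⟨k, hk⟩ := (hcut.eventually (gt_mem_nhds (show (0 : ℝ) < ε / 3 by positivity))).exists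
  set h : X.carrier := (f - g) + X.cut g (B k)ᶜ (hBm k).compl with hh
  have hnorm : X.norm h < X.distTo f X.orderContinuousPart + ε / 3 + ε / 3 :=
    (map_add_le_add _ _ _).trans_lt (add_lt_add hgd hk)
  have hhx : ∀ᵐ x ∂μ, (h : α →ₘ[μ] ℝ) x =
      (f : α →ₘ[μ] ℝ) x - (B k).indicator (g : α →ₘ[μ] ℝ) x := by
    filter_upwards [X.coeFn_carrier_add (f - g) (X.cut g (B k)ᶜ (hBm k).compl),
      X.coeFn_carrier_sub f g, X.coeFn_cut g (hBm k).compl] with x h1 h2 h3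
    rw [hh, h1, h2, h3]
    by_cases hx : x ∈ B k <;> simp [hx]
  have hfh : ∀ᵐ x ∂μ, |(f : α →ₘ[μ] ℝ) x| ≤ |(h : α →ₘ[μ] ℝ) x| + k := by
    filter_upwards [hhx] with x hx
    have h1 : |(B k).indicator (g : α →ₘ[μ] ℝ) x| ≤ k := by
      by_cases hxB : x ∈ B k
      · rw [indicator_of_mem hxB]
        exact hxB.1
      · rw [indicator_of_notMem hxB, abs_zero]
        positivity
    have h2 : (f : α →ₘ[μ] ℝ) x =
        (h : α →ₘ[μ] ℝ) x + (B k).indicator (g : α →ₘ[μ] ℝ) x := by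
      rw [hx]
      ring
    rw [h2]
    exact (abs_add_le _ _).trans (by linarith)
  have hfB : ∀ᵐ x ∂μ, x ∉ B k → |(f : α →ₘ[μ] ℝ) x| ≤ |(h : α →ₘ[μ] ℝ) x| := by
    filter_upwards [hhx] with x hx hxB
    rw [hx, indicator_of_notMem hxB, sub_zero]
  obtain ⟨δ, hδ, hδA⟩ := hX (ε / 3 / (k + 1)) (by positivity)
  have htail : ∀ᶠ n in atTop, 1 + μ (B k) ≤ μ {x | τ x < σ n} ∨ μ {x | σ n ≤ τ x} = 0 := by
    rcases C.tail with ht | ht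
    · have hfin : 1 + μ (B k) < ∞ := ENNReal.add_lt_top.2 ⟨ENNReal.one_lt_top, hBfin k⟩
      filter_upwards [ht.eventually (lt_mem_nhds hfin)] with n hn using Or.inl hn.le
    · exact Eventually.of_forall fun n => Or.inr (ht n)
  obtain ⟨N, hN⟩ := eventually_atTop.1 (htail.and
    ((C.tendsto_inner.eventually (gt_mem_nhds hδ)).and
      (C.tendsto_inner.eventually (gt_mem_nhds one_pos))))
  refine ⟨N, fun n hn => ?_⟩
  obtain ⟨ht, hnδ, hn1⟩ := hN n hn
  have hS : MeasurableSet {x | τ x < ρ n} := measurableSet_lt C.measurable measurable_const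
  obtain ⟨hSX, hSlt⟩ := hδA _ hS hnδ
  have hlow := X.distTo_le_norm_cut_starAlong C hX f (hO n) (hOn n)
  have hupp := X.norm_cut_starAlong_le C f h k.cast_nonneg hfh hfB (hO n) (hOn n) hS hSX hn1.le ht
  have h3 : (k : ℝ) * X.norm ⟨_, hSX⟩ ≤ ε / 3 := by
    refine (mul_le_mul_of_nonneg_left hSlt.le k.cast_nonneg).trans ?_
    rw [mul_div_assoc', div_le_iff₀ (by positivity)]
    nlinarith
  rw [Real.dist_eq, abs_of_nonneg (sub_nonneg.2 hlow)]
  linarith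

lemma starAlong_congr (hτ : Measurable τ) {f g : α →ₘ[μ] ℝ} (h : Equimeasurable f g) :
    starAlong τ hτ f = starAlong τ hτ g := by
  have hr : rearrangement f = rearrangement g := funext fun t => le_antisymm
    (rearrangement_mono_of_distributionFun_le (fun s hs => (h s hs).le) t)
    (rearrangement_mono_of_distributionFun_le (fun s hs => (h s hs).ge) t)
  refine AEEqFun.ext ?_
  filter_upwards [coeFn_starAlong hτ f, coeFn_starAlong hτ g] with x h1 h2
  rw [h1, h2, hr]

/-- The rearrangement is equimeasurable with `f`, hence its own rearrangement, so both distances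
are given by the same limit. -/
theorem tendsto_norm_cut_starAlong_both [SigmaFinite μ] (C : IsCoordinate μ τ ρ σ)
    (hX : X.FundamentalVanishes) (f : X.carrier) {O : ℕ → Set α}
    (hO : ∀ n, MeasurableSet (O n))
    (hOn : ∀ n, ∀ᵐ x ∂μ, x ∈ O n ↔ τ x < ρ n ∨ σ n ≤ τ x)
    {F : α →ₘ[μ] ℝ} (hF : F = starAlong τ C.measurable (f : α →ₘ[μ] ℝ)) :
    ∃ hf : F ∈ X.carrier,
      Tendsto (fun n => X.norm (X.cut ⟨F, hf⟩ (O n) (hO n))) atTop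
        (𝓝 (X.distTo ⟨F, hf⟩ X.orderContinuousPart)) ∧
      Tendsto (fun n => X.norm (X.cut ⟨F, hf⟩ (O n) (hO n))) atTop
        (𝓝 (X.distTo f X.orderContinuousPart)) := by
  subst hF
  refine ⟨X.starAlong_mem C f, ?_, X.tendsto_norm_cut_starAlong C hX f hO hOn⟩
  have heq : starAlong τ C.measurable (starAlong τ C.measurable (f : α →ₘ[μ] ℝ)) =
      starAlong τ C.measurable (f : α →ₘ[μ] ℝ) :=
    starAlong_congr C.measurable
      (C.equimeasurable_starAlong _ (X.exists_distributionFun_lt_top f)).symm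
  have h := X.tendsto_norm_cut_starAlong C hX ⟨_, X.starAlong_mem C f⟩ hO hOn
  simpa only [heq] using h

end RearrangementInvariantSpace

/-! ### The unit interval and the half-line -/

section Interval

variable {Ω : Set ℝ}

lemma measurableSet_of_interval (hΩ : Ω = Ioo 0 1 ∨ Ω = Ioi 0) : MeasurableSet Ω := by
  rcases hΩ with rfl | rfl
  · exact measurableSet_Ioo
  · exact measurableSet_Ioi

lemma pos_of_mem_interval (hΩ : Ω = Ioo 0 1 ∨ Ω = Ioi 0) {x : ℝ} (hx : x ∈ Ω) : 0 < x := by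
  rcases hΩ with rfl | rfl
  · exact hx.1
  · exact hx

lemma volume_restrict_toNNReal_lt (hΩ : Ω = Ioo 0 1 ∨ Ω = Ioi 0) (t : ℝ≥0) :
    (volume.restrict Ω) {x : ℝ | x.toNNReal < t} = volume (Ioo 0 (t : ℝ) ∩ Ω) := by
  rw [Measure.restrict_apply (measurableSet_lt measurable_real_toNNReal measurable_const)]
  congr 1
  ext x
  refine and_congr_left fun hx => ?_
  have h0 := pos_of_mem_interval hΩ hx
  change x.toNNReal < t ↔ 0 < x ∧ x < t
  rw [Real.toNNReal_lt_iff_lt_coe h0.le]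
  exact ⟨fun h => ⟨h0, h⟩, fun h => h.2⟩

lemma volume_restrict_toNNReal_lt_le (hΩ : Ω = Ioo 0 1 ∨ Ω = Ioi 0) (t : ℝ≥0) :
    (volume.restrict Ω) {x : ℝ | x.toNNReal < t} ≤ t := by
  rw [volume_restrict_toNNReal_lt hΩ]
  refine (measure_mono inter_subset_left).trans ?_
  rw [Real.volume_Ioo, sub_zero, ENNReal.ofReal_coe_nnreal]

lemma volume_restrict_toNNReal_lt_eq (hΩ : Ω = Ioo 0 1 ∨ Ω = Ioi 0) (t : ℝ≥0)
    (ht : Ω = Ioi 0 ∨ t ≤ 1) :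
    (volume.restrict Ω) {x : ℝ | x.toNNReal < t} = t := by
  rw [volume_restrict_toNNReal_lt hΩ]
  have h : Ioo 0 (t : ℝ) ∩ Ω = Ioo 0 (t : ℝ) := by
    refine inter_eq_left.2 fun x hx => ?_
    rcases ht with rfl | ht
    · exact hx.1
    · rcases hΩ with rfl | rfl
      · exact ⟨hx.1, hx.2.trans_le (by exact_mod_cast ht)⟩
      · exact hx.1
  rw [h, Real.volume_Ioo, sub_zero, ENNReal.ofReal_coe_nnreal]

lemma isThreshold_of_pos {α : Type*} [MeasurableSpace α] {μ : Measure α} {t : ℝ≥0}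
    (ht : 0 < t) : IsThreshold μ t :=
  ⟨t, by exact_mod_cast ht, fun _ _ h => h.le⟩

lemma isCoordinate_interval (hΩ : Ω = Ioo 0 1 ∨ Ω = Ioi 0) :
    IsCoordinate (volume.restrict Ω) Real.toNNReal (fun n => 1 / ((n : ℝ≥0) + 1))
      (fun n => (n : ℝ≥0) + 1) where
  measurable := measurable_real_toNNReal
  measure_lt A hA := by
    rcases eq_or_ne ((volume.restrict Ω) A) ∞ with htop | hne
    · rcases hΩ with rfl | rfl
      · refine absurd htop ((measure_mono (subset_univ A)).trans_lt ?_).ne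
        simp
      · rw [htop]
        simp
    · lift (volume.restrict Ω) A to ℝ≥0 using hne with m hm
      simp only [ENNReal.coe_lt_coe]
      refine volume_restrict_toNNReal_lt_eq hΩ m ?_
      rcases hΩ with rfl | rfl
      · right
        have h : (m : ℝ≥0∞) ≤ 1 := by
          rw [hm]
          refine (measure_mono (subset_univ A)).trans ?_
          simp
        exact_mod_cast h
      · exact Or.inl rfl
  isThreshold n := isThreshold_of_pos (by positivity)
  le n := by
    refine le_trans ?_ (show (1 : ℝ≥0) ≤ (n : ℝ≥0) + 1 by simp)
    rw [div_le_one (by positivity)]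
    simp
  ae_isThreshold := by
    filter_upwards [ae_restrict_mem (measurableSet_of_interval hΩ)] with x hx
    exact isThreshold_of_pos (Real.toNNReal_pos.2 (pos_of_mem_interval hΩ hx))
  tendsto_inner := by
    refine tendsto_of_tendsto_of_tendsto_of_le_of_le tendsto_const_nhds ?_ (fun _ => zero_le)
      (fun n => volume_restrict_toNNReal_lt_le hΩ _)
    have h : Tendsto (fun n : ℕ => 1 / ((n : ℝ≥0) + 1)) atTop (𝓝 0) :=
      tendsto_one_div_add_atTop_nhds_zero_nat
    exact ENNReal.tendsto_coe.2 h
  measure_lt_top n := (volume_restrict_toNNReal_lt_le hΩ _).trans_lt ENNReal.coe_lt_top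
  tail := by
    by_cases h : Ω = Ioi 0
    · left
      simp only [volume_restrict_toNNReal_lt_eq hΩ _ (Or.inl h)]
      have h1 : Tendsto (fun n : ℕ => ((n + 1 : ℕ) : ℝ≥0∞)) atTop (𝓝 ∞) :=
        ENNReal.tendsto_nat_nhds_top.comp (tendsto_add_atTop_nat 1)
      simpa using h1
    · right
      intro n
      have h' := hΩ.resolve_right h
      subst h'
      rw [Measure.restrict_apply (measurableSet_le measurable_const measurable_real_toNNReal)]
      refine measure_mono_null (t := ∅) ?_ measure_empty
      rintro x ⟨hx : (n : ℝ≥0) + 1 ≤ x.toNNReal, hx0, hx1⟩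
      have h2 : x.toNNReal < 1 := by
        rw [Real.toNNReal_lt_iff_lt_coe hx0.le]
        exact_mod_cast hx1
      exact absurd (le_trans (show (1 : ℝ≥0) ≤ (n : ℝ≥0) + 1 by simp) hx) h2.not_ge
  split := by
    refine ⟨Iio (1 / 2), measurableSet_Iio, fun B hB => ?_⟩
    rcases hΩ with rfl | rfl
    · have huniv : (volume.restrict (Ioo (0 : ℝ) 1)) univ = ENNReal.ofReal 1 := by simp
      have hhalf : ENNReal.ofReal (1 / 2) < ENNReal.ofReal 1 :=
        (ENNReal.ofReal_lt_ofReal_iff one_pos).2 (by norm_num)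
      rw [huniv]
      constructor
      · refine lt_of_le_of_lt ?_ hhalf
        refine (measure_mono inter_subset_right).trans ?_
        rw [Measure.restrict_apply measurableSet_Iio]
        refine (measure_mono (t := Ioo 0 (1 / 2)) ?_).trans (by simp)
        exact fun x hx => ⟨hx.2.1, hx.1⟩
      · refine lt_of_le_of_lt ?_ hhalf
        refine (measure_mono (t := Ici (1 / 2)) fun x hx => not_lt.1 hx.2).trans ?_
        rw [Measure.restrict_apply measurableSet_Ici]
        refine (measure_mono (t := Icc (1 / 2) 1) fun x hx => ⟨hx.1, hx.2.2.le⟩).trans ?_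
        rw [Real.volume_Icc]
        norm_num
    · have huniv : (volume.restrict (Ioi (0 : ℝ))) univ = ∞ := by simp
      rw [huniv]
      exact ⟨(measure_mono inter_subset_left).trans_lt hB,
        (measure_mono sdiff_subset).trans_lt hB⟩

/-- A nonzero order continuous element is bounded below on a set of positive measure, which
contains sets of arbitrarily small positive measure shrinking to a point; their indicators
therefore tend to zero in norm. -/
lemma fundamentalVanishes_interval (hΩ : Ω = Ioo 0 1 ∨ Ω = Ioi 0)
    (X : RearrangementInvariantSpace (volume.restrict Ω))
    (hXa : ∃ g ∈ X.orderContinuousPart, g ≠ 0) : X.FundamentalVanishes := by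
  have C := isCoordinate_interval hΩ
  obtain ⟨g, hg, hg0⟩ := hXa
  set G : ℝ →ₘ[volume.restrict Ω] ℝ := (g : ℝ →ₘ[volume.restrict Ω] ℝ) with hG
  have hpos : 0 < distributionFun G 0 := by
    rw [pos_iff_ne_zero]
    intro h0
    refine hg0 (Subtype.ext (AEEqFun.ext ?_))
    have h1 : ∀ᵐ x ∂(volume.restrict Ω), ¬ 0 < |G x| := measure_eq_zero_iff_ae_notMem.1 h0
    filter_upwards [h1,
      AEEqFun.coeFn_zero (μ := volume.restrict Ω) (β := ℝ) (α := ℝ)] with x hx hz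
    change G x = (0 : ℝ →ₘ[volume.restrict Ω] ℝ) x
    rw [hz]
    simpa using hx
  obtain ⟨c, hc, hcpos⟩ := exists_gt_lt_distributionFun G hpos
  obtain ⟨x, -, hx⟩ := exists_mem_forall_mem_nhdsWithin_pos_measure
    (μ := volume.restrict Ω) (s := {t | c < |G t|}) hcpos.ne'
  set A : ℕ → Set ℝ := fun n => {t | c < |G t|} ∩ Metric.ball x (1 / ((n : ℝ) + 1)) with hA
  have hAm : ∀ n, MeasurableSet (A n) := fun n =>
    (measurableSet_lt_abs G c).inter measurableSet_ball
  have hApos : ∀ n, 0 < (volume.restrict Ω) (A n) := fun n =>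
    hx _ (inter_mem_nhdsWithin _ (Metric.ball_mem_nhds x Nat.one_div_pos_of_nat))
  have hanti : Antitone A := fun m n hmn => inter_subset_inter_right _
    (Metric.ball_subset_ball (Nat.one_div_le_one_div hmn))
  have hnull : ∀ᵐ y ∂(volume.restrict Ω), ∃ n, y ∉ A n := by
    have h1 : ∀ᵐ y ∂(volume.restrict Ω), y ∉ ({x} : Set ℝ) :=
      measure_eq_zero_iff_ae_notMem.1 (measure_singleton x)
    filter_upwards [h1] with y hy
    obtain ⟨n, hn⟩ := exists_nat_one_div_lt (dist_pos.2 hy)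
    exact ⟨n, fun h => hn.not_gt h.2⟩
  intro ε hε
  obtain ⟨n, hn⟩ := ((X.tendsto_norm_cut_of_mem hg hAm hanti hnull).eventually
    (gt_mem_nhds (show (0 : ℝ) < c * ε by positivity))).exists
  refine ⟨_, hApos n, fun D hD hDlt => ?_⟩
  have hdom : ∀ s, 0 ≤ s → distributionFun (indicatorClass (volume.restrict Ω) hD) s ≤
      distributionFun ((c⁻¹ • X.cut g (A n) (hAm n) : X.carrier) :
        ℝ →ₘ[volume.restrict Ω] ℝ) s := by
    intro s hs
    rcases lt_or_ge s 1 with hs1 | hs1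
    · refine (distributionFun_indicatorClass_le hD hs).trans (hDlt.le.trans
        (measure_mono_ae ?_))
      filter_upwards [X.coeFn_carrier_smul c⁻¹ (X.cut g (A n) (hAm n)),
        X.coeFn_cut g (hAm n)] with y h1 h2 (hy : y ∈ A n)
      change s < |_|
      rw [h1, h2, indicator_of_mem hy, abs_mul, abs_of_pos (inv_pos.2 hc)]
      refine hs1.trans ?_
      rw [inv_mul_eq_div, one_lt_div hc]
      exact hy.1
    · rw [distributionFun_indicatorClass_of_one_le hD hs1]
      exact zero_le
  obtain ⟨hm, hle⟩ := X.mem_and_norm_le_of_distributionFun_le C _ hdom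
  refine ⟨hm, hle.trans_lt ?_⟩
  rwa [map_smul_eq_mul, norm_inv, Real.norm_of_nonneg hc.le, inv_mul_lt_iff₀ hc]

lemma ae_mem_outerSet_iff (hΩ : Ω = Ioo 0 1 ∨ Ω = Ioi 0) (n : ℕ) :
    ∀ᵐ x ∂(volume.restrict Ω), x ∈ outerSet Ω (n + 1) ↔
      x.toNNReal < 1 / ((n : ℝ≥0) + 1) ∨ (n : ℝ≥0) + 1 ≤ x.toNNReal := by
  have h1 : ∀ᵐ y ∂(volume.restrict Ω), y ∉ ({(n : ℝ) + 1} : Set ℝ) :=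
    measure_eq_zero_iff_ae_notMem.1 (measure_singleton _)
  filter_upwards [h1, ae_restrict_mem (measurableSet_of_interval hΩ)] with x hx hxΩ
  have h0 := pos_of_mem_interval hΩ hxΩ
  have hne : x ≠ (n : ℝ) + 1 := hx
  rw [Real.toNNReal_lt_iff_lt_coe h0.le, Real.le_toNNReal_iff_coe_le h0.le]
  simp only [outerSet, mem_inter_iff, hxΩ, true_and, mem_union, mem_Ioo, mem_Ioi, h0]
  push_cast
  refine or_congr Iff.rfl ⟨le_of_lt, fun h => lt_of_le_of_ne h hne.symm⟩

end Interval

/-! ### The positive integers -/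

section PosInt

lemma count_natPred_lt (N : ℕ) :
    (Measure.count : Measure ℕ+) {k | k.natPred < N} = N := by
  have h : {k : ℕ+ | k.natPred < N} = Nat.succPNat '' (Finset.range N : Set ℕ) := by
    ext k
    constructor
    · intro hk
      exact ⟨k.natPred, by simpa using hk, PNat.succPNat_natPred k⟩
    · rintro ⟨m, hm, rfl⟩
      simpa using hm
  rw [Measure.count_apply (MeasurableSet.of_discrete), h,
    Nat.succPNat_injective.encard_image, Set.encard_coe_eq_coe_finsetCard, Finset.card_range]
  simp

lemma count_eq_top_or_natCast (A : Set ℕ+) :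
    (Measure.count : Measure ℕ+) A = ∞ ∨ ∃ N : ℕ, (Measure.count : Measure ℕ+) A = N := by
  rw [Measure.count_apply (MeasurableSet.of_discrete)]
  rcases A.finite_or_infinite with h | h
  · exact Or.inr ⟨A.ncard, by rw [← h.cast_ncard_eq]; simp⟩
  · exact Or.inl (by rw [h.encard_eq]; simp)

lemma count_univ_posInt : (Measure.count : Measure ℕ+) univ = ∞ :=
  Measure.count_apply_infinite infinite_univ

lemma isThreshold_posInt (t : ℝ≥0) : IsThreshold (Measure.count : Measure ℕ+) t := by
  refine ⟨1, one_pos, fun A _ h => ?_⟩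
  rcases count_eq_top_or_natCast A with h1 | ⟨N, h1⟩
  · rw [h1] at h
    exact absurd h (by simp)
  · rw [h1] at h ⊢
    have hN : N = 0 := Nat.lt_one_iff.1 (by exact_mod_cast h)
    simp [hN]

lemma isCoordinate_posInt :
    IsCoordinate (Measure.count : Measure ℕ+) (fun k => (k.natPred : ℝ≥0)) (fun _ => 0)
      (fun n => (n : ℝ≥0) + 1) where
  measurable := measurable_of_countable _
  measure_lt A hA := by
    rcases count_eq_top_or_natCast A with h | ⟨N, h⟩
    · rw [h]
      simp
    · rw [h, ← count_natPred_lt N]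
      congr 1
      ext k
      change ((k.natPred : ℝ≥0) : ℝ≥0∞) < _ ↔ _
      rw [count_natPred_lt]
      simp
  isThreshold n := isThreshold_posInt _
  le n := zero_le
  ae_isThreshold := Eventually.of_forall fun x => isThreshold_posInt _
  tendsto_inner := by simp
  measure_lt_top n := by
    have h := count_natPred_lt (n + 1)
    refine lt_of_eq_of_lt ?_ (ENNReal.natCast_lt_top (n + 1))
    rw [← h]
    congr 1
    ext k
    change (k.natPred : ℝ≥0) < n + 1 ↔ k.natPred < n + 1
    exact_mod_cast Iff.rfl
  tail := by
    left
    have h1 : Tendsto (fun n : ℕ => ((n + 1 : ℕ) : ℝ≥0∞)) atTop (𝓝 ∞) :=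
      ENNReal.tendsto_nat_nhds_top.comp (tendsto_add_atTop_nat 1)
    refine h1.congr fun n => ?_
    rw [← count_natPred_lt]
    congr 1
    ext k
    change k.natPred < n + 1 ↔ (k.natPred : ℝ≥0) < n + 1
    exact_mod_cast Iff.rfl
  split := by
    refine ⟨univ, MeasurableSet.univ, fun B hB => ?_⟩
    rw [count_univ_posInt]
    exact ⟨(measure_mono inter_subset_left).trans_lt hB, (measure_mono sdiff_subset).trans_lt hB⟩

/-- In a counting space a set of measure less than one is empty. -/
lemma fundamentalVanishes_posInt
    (X : RearrangementInvariantSpace (Measure.count : Measure ℕ+)) : X.FundamentalVanishes := by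
  intro ε hε
  refine ⟨1, one_pos, fun A hA h => ?_⟩
  have hA0 : (Measure.count : Measure ℕ+) A = 0 := by
    rcases count_eq_top_or_natCast A with h1 | ⟨N, h1⟩
    · rw [h1] at h
      exact absurd h (by simp)
    · rw [h1] at h ⊢
      have hN : N = 0 := Nat.lt_one_iff.1 (by exact_mod_cast h)
      simp [hN]
  have hz : indicatorClass (Measure.count : Measure ℕ+) hA = 0 := by
    refine AEEqFun.ext ?_
    filter_upwards [coeFn_indicatorClass hA, measure_eq_zero_iff_ae_notMem.1 hA0,
      AEEqFun.coeFn_zero (μ := (Measure.count : Measure ℕ+)) (β := ℝ) (α := ℕ+)] with x h1 h2 h3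
    rw [h1, h3, indicator_of_notMem h2]
    rfl
  have hm : indicatorClass (Measure.count : Measure ℕ+) hA ∈ X.carrier := by
    rw [hz]
    exact X.carrier.zero_mem
  refine ⟨hm, ?_⟩
  have : (⟨_, hm⟩ : X.carrier) = 0 := Subtype.ext hz
  rw [this, map_zero]
  exact hε

lemma seqRearrangement_eq (x : ℕ+ →ₘ[(Measure.count : Measure ℕ+)] ℝ) (n : ℕ+) :
    seqRearrangement x n = rearrangement x ((n.natPred : ℝ≥0) : ℝ) := by
  have h : ∀ s, distributionFun x s < ((n : ℕ) : ℝ≥0∞) ↔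
      distributionFun x s ≤ ENNReal.ofReal ((n.natPred : ℝ≥0) : ℝ) := by
    intro s
    rw [ENNReal.ofReal_coe_nnreal]
    rcases count_eq_top_or_natCast {t | s < |x t|} with h1 | ⟨N, h1⟩
    · have h2 : distributionFun x s = ∞ := h1
      simp [h2]
    · have h2 : distributionFun x s = N := h1
      rw [h2]
      have h3 := PNat.natPred_add_one n
      rw [← h3]
      simp only [ENNReal.coe_natCast, Nat.cast_lt, Nat.cast_le]
      exact Nat.lt_succ_iff
  simp only [seqRearrangement, rearrangement, h]

lemma mem_seqOuterSet_iff (n : ℕ) (k : ℕ+) :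
    k ∈ seqOuterSet (n + 1) ↔ (k.natPred : ℝ≥0) < 0 ∨ (n : ℝ≥0) + 1 ≤ k.natPred := by
  have h3 := PNat.natPred_add_one k
  have hk : (1 : ℝ) ≤ ((k : ℕ) : ℝ) := by exact_mod_cast one_le
  have hn : 1 / (((n + 1 : ℕ) : ℝ)) ≤ 1 := by
    rw [div_le_one (by positivity)]
    exact_mod_cast Nat.succ_le_succ n.zero_le
  have h4 : ((n : ℝ≥0) + 1 ≤ k.natPred) ↔ ((n + 1 : ℕ) : ℝ) < ((k : ℕ) : ℝ) := by
    rw [← h3, Nat.cast_lt, Nat.lt_succ_iff]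
    exact_mod_cast Iff.rfl
  rw [h4]
  constructor
  · rintro (h | h)
    · exact absurd h.2 (by linarith)
    · exact Or.inr h
  · rintro (h | h)
    · exact absurd h (by simp)
    · exact Or.inr h

end PosInt

theorem mainTheorem5 :
    (∀ (Ω : Set ℝ) (hΩ : Ω = Ioo 0 1 ∨ Ω = Ioi 0)
      (X : RearrangementInvariantSpace (volume.restrict Ω)),
      (∃ g ∈ X.orderContinuousPart, g ≠ 0) →
      ∀ f : X.carrier,
        (∀ t ∈ Ω, rearrangement (f : ℝ →ₘ[volume.restrict Ω] ℝ) t < ∞) ∧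
        ∃ hf : rearrangementClass (f : ℝ →ₘ[volume.restrict Ω] ℝ) ∈ X.carrier,
          Tendsto (fun n : ℕ => X.norm
              (X.cut ⟨rearrangementClass (f : ℝ →ₘ[volume.restrict Ω] ℝ), hf⟩
                (outerSet Ω n) (measurableSet_outerSet hΩ n)))
            atTop
            (𝓝 (X.distTo ⟨rearrangementClass (f : ℝ →ₘ[volume.restrict Ω] ℝ), hf⟩
              X.orderContinuousPart)) ∧
          Tendsto (fun n : ℕ => X.norm
              (X.cut ⟨rearrangementClass (f : ℝ →ₘ[volume.restrict Ω] ℝ), hf⟩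
                (outerSet Ω n) (measurableSet_outerSet hΩ n)))
            atTop (𝓝 (X.distTo f X.orderContinuousPart))) ∧
    (∀ X : RearrangementInvariantSpace (Measure.count : Measure ℕ+),
      (∃ g ∈ X.orderContinuousPart, g ≠ 0) →
      ∀ x : X.carrier,
        (∀ n : ℕ+, seqRearrangement (x : ℕ+ →ₘ[(Measure.count : Measure ℕ+)] ℝ) n < ∞) ∧
        ∃ hx : seqRearrangementClass (x : ℕ+ →ₘ[(Measure.count : Measure ℕ+)] ℝ) ∈ X.carrier,
          Tendsto (fun n : ℕ => X.norm
              (X.cut ⟨seqRearrangementClass (x : ℕ+ →ₘ[(Measure.count : Measure ℕ+)] ℝ), hx⟩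
                (seqOuterSet n) (measurableSet_seqOuterSet n)))
            atTop
            (𝓝 (X.distTo ⟨seqRearrangementClass (x : ℕ+ →ₘ[(Measure.count : Measure ℕ+)] ℝ), hx⟩
              X.orderContinuousPart)) ∧
          Tendsto (fun n : ℕ => X.norm
              (X.cut ⟨seqRearrangementClass (x : ℕ+ →ₘ[(Measure.count : Measure ℕ+)] ℝ), hx⟩
                (seqOuterSet n) (measurableSet_seqOuterSet n)))
            atTop (𝓝 (X.distTo x X.orderContinuousPart))) := by
  constructor
  · intro Ω hΩ X hXa f
    have C := isCoordinate_interval hΩ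
    have hfin := X.exists_distributionFun_lt_top f
    refine ⟨fun t ht => ?_, ?_⟩
    · have h0 := pos_of_mem_interval hΩ ht
      have h := (isThreshold_of_pos (μ := volume.restrict Ω)
        (Real.toNNReal_pos.2 h0)).rearrangement_lt_top (f : ℝ →ₘ[volume.restrict Ω] ℝ) hfin
      rwa [Real.coe_toNNReal t h0.le] at h
    · have heq : rearrangementClass (f : ℝ →ₘ[volume.restrict Ω] ℝ) =
          starAlong Real.toNNReal C.measurable (f : ℝ →ₘ[volume.restrict Ω] ℝ) := by
        refine AEEqFun.ext ?_
        filter_upwards [coeFn_starAlong C.measurable (f : ℝ →ₘ[volume.restrict Ω] ℝ),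
          AEEqFun.coeFn_mk (μ := volume.restrict Ω) _ (antitone_rearrangement
            (f : ℝ →ₘ[volume.restrict Ω] ℝ)).measurable.ennreal_toReal.aestronglyMeasurable,
          ae_restrict_mem (measurableSet_of_interval hΩ)] with x h1 h2 hx
        rw [h1, Real.coe_toNNReal x (pos_of_mem_interval hΩ hx).le]
        exact h2
      -- The cut-offs `1 / n` and `n` make sense from `n = 1` on, hence the shift by one.
      obtain ⟨hf, h1, h2⟩ := X.tendsto_norm_cut_starAlong_both C
        (fundamentalVanishes_interval hΩ X hXa) f
        (fun n => measurableSet_outerSet hΩ (n + 1)) (ae_mem_outerSet_iff hΩ) heq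
      exact ⟨hf, (tendsto_add_atTop_iff_nat 1).1 h1, (tendsto_add_atTop_iff_nat 1).1 h2⟩
  · intro X hXa x
    have C := isCoordinate_posInt
    have hfin := X.exists_distributionFun_lt_top x
    refine ⟨fun n => ?_, ?_⟩
    · rw [seqRearrangement_eq]
      exact (isThreshold_posInt _).rearrangement_lt_top _ hfin
    · have heq : seqRearrangementClass (x : ℕ+ →ₘ[(Measure.count : Measure ℕ+)] ℝ) =
          starAlong _ C.measurable (x : ℕ+ →ₘ[(Measure.count : Measure ℕ+)] ℝ) := by
        refine AEEqFun.ext ?_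
        filter_upwards [coeFn_starAlong C.measurable
            (x : ℕ+ →ₘ[(Measure.count : Measure ℕ+)] ℝ),
          AEEqFun.coeFn_mk (μ := (Measure.count : Measure ℕ+))
            (fun n => (seqRearrangement (x : ℕ+ →ₘ[(Measure.count : Measure ℕ+)] ℝ) n).toReal)
            (measurable_of_countable _).aestronglyMeasurable] with n h1 h2
        rw [h1, ← seqRearrangement_eq]
        exact h2
      obtain ⟨hx, h1, h2⟩ := X.tendsto_norm_cut_starAlong_both C
        (fundamentalVanishes_posInt X) x (fun n => measurableSet_seqOuterSet (n + 1))
        (fun n => Eventually.of_forall (mem_seqOuterSet_iff n)) heq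
      exact ⟨hx, (tendsto_add_atTop_iff_nat 1).1 h1, (tendsto_add_atTop_iff_nat 1).1 h2⟩
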